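/- Consider the class $\mathcal F$ of the equations $$\mathcal F_{\alpha\beta}\colon\quad u_t+xu_y=|x-\alpha|^\beta u_{xx}$$ for an unknown function $u$ of $(t,x,y)$, where $(\alpha,\beta)$ runs through $\mathbb R^2$ and each equation is considered where $x\ne\alpha$. Let $U\subseteq\mathbb R^4_{t,x,y,u}$ be a nonempty connected open set. A (usual) equivalence transformation of $\mathcal F$ over $U$ is a smooth map $\mathscr T$ with nonvanishing Jacobian from $U\times\mathbb R^2_{\alpha,\beta}$ to $\mathbb R^6$, $(t,x,y,u,\alpha,\beta)\mapsto(\tilde t,\tilde x,\tilde y,\tilde u,\tilde\alpha,\tilde\beta)$, such that (1) the components $(\tilde t,\tilde x,\tilde y,\tilde u)=\Phi(t,x,y,u)$ do not depend on $(\alpha,\beta)$, and (2) for each $(\alpha,\beta)\in\mathbb R^2$, the components $(\tilde\alpha,\tilde\beta)$ of $\mathscr T$ are constant on $U\times\{(\alpha,\beta)\}$, and $\Phi$ maps $\mathcal F_{\alpha\beta}$ to $\mathcal F_{\tilde\alpha\tilde\beta}$: whenever $f$ and $\tilde f$ are smooth functions on open subsets of $\{x\ne\alpha\}$ and $\{\tilde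 x\ne\tilde\alpha\}$, respectively, such that the graph of $f$ is contained in $U$ and $\Phi$ maps it onto the graph of $\tilde f$, the function $f$ is a solution of $\mathcal F_{\alpha\beta}$ if and only if $\tilde f$ is a solution of $\mathcal F_{\tilde\alpha\tilde\beta}$. Then the equivalence transformations of $\mathcal F$ over $U$ are exactly the maps of the form $$\begin{aligned} &\tilde t=t+c_0,\quad \tilde x=\epsilon x+c_1,\quad \tilde y=\epsilon y+c_1t+c_2,\quad \tilde u=c_3u+c_4(tx-y)+c_5x+c_6,\\ &\tilde\alpha=\epsilon\alpha+c_1,\quad \tilde\beta=\beta, \end{aligned}$$ where $\epsilon=\pm1$ and $c_0,\dots,c_6$ are arbitrary real constants with $c_3\ne0$. In particular, for $U=\mathbb R^4$ these maps constitute the equivalence group $G^\sim_{\mathcal F}$ of the class $\mathcal F$. -/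

import Mathlib

open scoped ContDiff

noncomputable section

namespace KolmogorovClass

/-- The space of the independent variables `(t, x, y)`. -/
abbrev Base : Type := ℝ × ℝ × ℝ

/-- The space of the independent and dependent variables `((t, x, y), u)`. -/
abbrev Vars : Type := Base × ℝ

/-- The space of the arbitrary elements `(α, β)`. -/
abbrev Params : Type := ℝ × ℝ

/-- The joint space of the variables and the arbitrary elements, `(((t, x, y), u), (α, β))`. -/
abbrev Joint : Type := Vars × Params

/-- The partial derivative `∂f/∂t`. -/
def dt (f : Base → ℝ) (p : Base) : ℝ := fderiv ℝ f p (1, 0, 0)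

/-- The partial derivative `∂f/∂x`. -/
def dx (f : Base → ℝ) (p : Base) : ℝ := fderiv ℝ f p (0, 1, 0)

/-- The partial derivative `∂f/∂y`. -/
def dy (f : Base → ℝ) (p : Base) : ℝ := fderiv ℝ f p (0, 0, 1)

/-- The set `x ≠ α`, on which the diffusion coefficient `|x - α| ^ β` is defined,
smooth and nonzero for every `β`. -/
def regularSet (θ : Params) : Set Base := {p | p.2.1 ≠ θ.1}

/-- The equation `u_t + x u_y = |x - α| ^ β u_xx`, `θ = (α, β)`, holds for `u = f` on `W`. -/
def Solves (θ : Params) (f : Base → ℝ) (W : Set Base) : Prop :=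
  ∀ p ∈ W, dt f p + p.2.1 * dy f p = |p.2.1 - θ.1| ^ θ.2 * dx (dx f) p

/-- `f` is a smooth function on the open set `W`, on which the equation with the
parameters `θ` is regular. -/
structure IsLocalFunction (θ : Params) (f : Base → ℝ) (W : Set Base) : Prop where
  isOpen : IsOpen W
  subset_regularSet : W ⊆ regularSet θ
  contDiffOn : ContDiffOn ℝ ∞ f W

/-- The transformation `Φ` of the variables, considered on `U`, maps the equation with the
parameters `θ` to the equation with the parameters `θ'`: whenever `Φ` maps the graph of a smooth
function `f` of `(t, x, y)` to the graph of a smooth function `f'`, then `f` is a solution of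
the former equation if and only if `f'` is a solution of the latter. -/
def MapsEquation (U : Set Vars) (Φ : Vars → Vars) (θ θ' : Params) : Prop :=
  ∀ (W W' : Set Base) (f f' : Base → ℝ),
    IsLocalFunction θ f W → IsLocalFunction θ' f' W' →
    W.graphOn f ⊆ U → Φ '' W.graphOn f = W'.graphOn f' →
    (Solves θ f W ↔ Solves θ' f' W')

/-- A point transformation: a smooth map of the joint space with nonvanishing Jacobian on the
open set `Ω`. -/
def IsPointTransformationOn (Ω : Set Joint) (T : Joint → Joint) : Prop :=
  ContDiffOn ℝ ∞ T Ω ∧ ∀ w ∈ Ω, (fderiv ℝ T w).det ≠ 0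

/-- `T`, with the domain `U × ℝ²`, is a (usual) equivalence transformation of the class of the
equations `u_t + x u_y = |x - α| ^ β u_xx` with `(α, β) ∈ ℝ²`: it is a point transformation of
the joint space of the variables and the arbitrary elements that is projectable to the space of
the variables, and it maps each equation of the class to an equation of the class, the constant
values of the transformed arbitrary elements being given by the corresponding components
of `T`. -/
def IsEquivalenceTransformation (U : Set Vars) (T : Joint → Joint) : Prop :=
  IsPointTransformationOn (U ×ˢ Set.univ) T ∧
  ∃ Φ : Vars → Vars,
    (∀ z ∈ U, ∀ θ : Params, (T (z, θ)).1 = Φ z) ∧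
    ∀ θ : Params, ∃ θ' : Params,
      (∀ z ∈ U, (T (z, θ)).2 = θ') ∧ MapsEquation U Φ θ θ'

end KolmogorovClass

end

namespace KolmogorovClass

open Filter Topology Set

section Calculus

variable {E F : Type*} [NormedAddCommGroup E] [NormedSpace ℝ E]
  [NormedAddCommGroup F] [NormedSpace ℝ F]

/-- The first and second derivatives of a composition `g ∘ c` with a curve `c`. -/
theorem hasDerivAt_comp_curve {g : E → F} {c c₁ : ℝ → E} {c₂ : E}
    (hg : ContDiffAt ℝ ∞ g (c 0)) (hc : ∀ᶠ s in 𝓝 (0 : ℝ), HasDerivAt c (c₁ s) s)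
    (hc₁ : HasDerivAt c₁ c₂ 0) :
    (∀ᶠ s in 𝓝 (0 : ℝ), HasDerivAt (fun s => g (c s)) (fderiv ℝ g (c s) (c₁ s)) s) ∧
    HasDerivAt (fun s => fderiv ℝ g (c s) (c₁ s))
      (fderiv ℝ (fderiv ℝ g) (c 0) (c₁ 0) (c₁ 0) + fderiv ℝ g (c 0) c₂) 0 := by
  have hcc : ContinuousAt c 0 := hc.self_of_nhds.continuousAt
  constructor
  · have hg1 : ContDiffAt ℝ 1 g (c 0) := hg.of_le (by exact_mod_cast le_top)
    have h1 : ∀ᶠ z in 𝓝 (c 0), DifferentiableAt ℝ g z := by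
      have := hg1.eventually (by simp)
      filter_upwards [this] with z hz using hz.differentiableAt (by simp)
    filter_upwards [hc, hcc.eventually h1] with s hs hgs
    exact hgs.hasFDerivAt.comp_hasDerivAt s hs
  · have hd : ContDiffAt ℝ 1 (fderiv ℝ g) (c 0) := hg.fderiv_right (by norm_cast)
    have h2 : HasFDerivAt (fderiv ℝ g) (fderiv ℝ (fderiv ℝ g) (c 0)) (c 0) :=
      (hd.differentiableAt (by simp)).hasFDerivAt
    have h3 := h2.comp_hasDerivAt (0 : ℝ) hc.self_of_nhds
    exact h3.clm_apply hc₁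

/-- The relations between the jets of `f` and `f'` if `Φ` maps the graph of `f` to the
graph of `f'`. -/
theorem jet_relations {Φ : E × ℝ → F × ℝ} {f : E → ℝ} {f' : F → ℝ} {p : E}
    (hΦ : ContDiffAt ℝ ∞ Φ (p, f p)) (hf : ContDiffAt ℝ ∞ f p)
    (hf' : ContDiffAt ℝ ∞ f' (Φ (p, f p)).1)
    (h : ∀ᶠ q in 𝓝 p, f' (Φ (q, f q)).1 = (Φ (q, f q)).2) (e : E) :
    fderiv ℝ f' (Φ (p, f p)).1 (fderiv ℝ Φ (p, f p) (e, fderiv ℝ f p e)).1 =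
      (fderiv ℝ Φ (p, f p) (e, fderiv ℝ f p e)).2 ∧
    fderiv ℝ (fderiv ℝ f') (Φ (p, f p)).1 (fderiv ℝ Φ (p, f p) (e, fderiv ℝ f p e)).1
        (fderiv ℝ Φ (p, f p) (e, fderiv ℝ f p e)).1 +
      fderiv ℝ f' (Φ (p, f p)).1
        (fderiv ℝ (fderiv ℝ Φ) (p, f p) (e, fderiv ℝ f p e) (e, fderiv ℝ f p e) +
          fderiv ℝ Φ (p, f p) (0, fderiv ℝ (fderiv ℝ f) p e e)).1 =
      (fderiv ℝ (fderiv ℝ Φ) (p, f p) (e, fderiv ℝ f p e) (e, fderiv ℝ f p e) +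
          fderiv ℝ Φ (p, f p) (0, fderiv ℝ (fderiv ℝ f) p e e)).2 := by
  set c : ℝ → E := fun s => p + s • e with hc
  have hc0 : c 0 = p := by simp [hc]
  have hcd : ∀ s, HasDerivAt c e s := fun s => by
    simpa [hc] using ((hasDerivAt_id s).smul_const e).const_add p
  have hf0 : ContDiffAt ℝ ∞ f (c 0) := by rwa [hc0]
  obtain ⟨a1, a2⟩ := hasDerivAt_comp_curve (g := f) (c₁ := fun _ => e) (c₂ := 0) hf0
    (Eventually.of_forall hcd) (hasDerivAt_const _ _)
  obtain ⟨b1, b2⟩ := hasDerivAt_comp_curve (g := Φ) (c := fun s => (c s, f (c s)))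
    (c₁ := fun s => (e, fderiv ℝ f (c s) e))
    (c₂ := (0, fderiv ℝ (fderiv ℝ f) (c 0) e e + fderiv ℝ f (c 0) 0))
    (by simpa [hc0] using hΦ)
    (a1.mono fun s hs => (hcd s).prodMk hs) ((hasDerivAt_const _ _).prodMk a2)
  obtain ⟨d1, d2⟩ := hasDerivAt_comp_curve (g := f') (c := fun s => (Φ (c s, f (c s))).1)
    (c₁ := fun s => (fderiv ℝ Φ (c s, f (c s)) (e, fderiv ℝ f (c s) e)).1)
    (by simpa [hc0] using hf') (b1.mono fun s hs => hs.fst) b2.fst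
  have hev : (fun s => f' (Φ (c s, f (c s))).1) =ᶠ[𝓝 0] fun s => (Φ (c s, f (c s))).2 := by
    have : Tendsto c (𝓝 0) (𝓝 p) := by
      simpa [hc0] using (hcd 0).continuousAt.tendsto
    exact this.eventually h
  have hev1 : (fun s => fderiv ℝ f' (Φ (c s, f (c s))).1
      (fderiv ℝ Φ (c s, f (c s)) (e, fderiv ℝ f (c s) e)).1) =ᶠ[𝓝 0]
      fun s => (fderiv ℝ Φ (c s, f (c s)) (e, fderiv ℝ f (c s) e)).2 := by
    filter_upwards [hev.eventually_nhds, b1, d1] with s h1 h2 h3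
    have h4 : HasDerivAt (fun s => (Φ (c s, f (c s))).2) _ s := h2.snd
    exact h3.unique (h4.congr_of_eventuallyEq h1)
  have h0 := hev1.self_of_nhds
  have b3 : HasDerivAt (fun s => (fderiv ℝ Φ (c s, f (c s)) (e, fderiv ℝ f (c s) e)).2) _ 0 :=
    b2.snd
  have h1 := d2.unique (b3.congr_of_eventuallyEq hev1)
  simp only [hc0, map_zero, add_zero] at h0 h1
  exact ⟨h0, h1⟩

/-- A map transverse to the graph of a smooth function `f` locally maps this graph to the graph
of a smooth function. -/
theorem exists_graph_image [FiniteDimensional ℝ E] {U : Set (E × ℝ)} (hU : IsOpen U)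
    {Φ : E × ℝ → E × ℝ} (hΦ : ContDiffOn ℝ ∞ Φ U) {R R' : Set E} (hR : IsOpen R)
    (hR' : IsOpen R') {f : E → ℝ} (hf : ContDiffOn ℝ ∞ f R) {p : E} (hp : p ∈ R)
    (hpU : (p, f p) ∈ U) (hpR' : (Φ (p, f p)).1 ∈ R')
    (htr : ∀ e, (fderiv ℝ Φ (p, f p) (e, fderiv ℝ f p e)).1 = 0 → e = 0) :
    ∃ (W W' : Set E) (f' : E → ℝ), IsOpen W ∧ IsOpen W' ∧ p ∈ W ∧ W ⊆ R ∧ W' ⊆ R' ∧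
      ContDiffOn ℝ ∞ f' W' ∧ W.graphOn f ⊆ U ∧ Φ '' W.graphOn f = W'.graphOn f' := by
  have : CompleteSpace E := FiniteDimensional.complete ℝ E
  set σ : E → E := fun q => (Φ (q, f q)).1 with hσ
  set R₁ : Set E := R ∩ (fun q => (q, f q)) ⁻¹' U with hR₁
  have hR₁o : IsOpen R₁ :=
    (continuousOn_id.prodMk hf.continuousOn).isOpen_inter_preimage hR hU
  have hΦf : ContDiffOn ℝ ∞ (fun q => Φ (q, f q)) R₁ :=
    hΦ.comp (contDiffOn_id.prodMk (hf.mono inter_subset_left)) fun q hq => hq.2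
  have hσd : ContDiffOn ℝ ∞ σ R₁ := hΦf.fst
  have hpR₁ : p ∈ R₁ := ⟨hp, hpU⟩
  have hσf : fderiv ℝ σ p = (ContinuousLinearMap.fst ℝ E ℝ).comp
      ((fderiv ℝ Φ (p, f p)).comp ((ContinuousLinearMap.id ℝ E).prod (fderiv ℝ f p))) := by
    have h1 : HasFDerivAt f (fderiv ℝ f p) p :=
      ((hf.contDiffAt (hR.mem_nhds hp)).differentiableAt (by simp)).hasFDerivAt
    have h2 : HasFDerivAt Φ (fderiv ℝ Φ (p, f p)) (p, f p) :=
      ((hΦ.contDiffAt (hU.mem_nhds hpU)).differentiableAt (by simp)).hasFDerivAt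
    have h3 : HasFDerivAt (fun q => Φ (q, f q)) _ p :=
      HasFDerivAt.comp p (f := fun q => (q, f q)) h2 ((hasFDerivAt_id p).prodMk h1)
    exact h3.fst.fderiv
  have hinj : Function.Injective (fderiv ℝ σ p : E →ₗ[ℝ] E) := by
    rw [← LinearMap.ker_eq_bot, LinearMap.ker_eq_bot']
    intro e he
    apply htr
    simpa [hσf] using he
  obtain ⟨A, hA⟩ : ∃ A : E ≃L[ℝ] E, (A : E →L[ℝ] E) = fderiv ℝ σ p :=
    ⟨(LinearEquiv.ofInjectiveEndo _ hinj).toContinuousLinearEquiv, by ext e; rfl⟩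
  have hσp : ContDiffAt ℝ ∞ σ p := hσd.contDiffAt (hR₁o.mem_nhds hpR₁)
  have hder : HasFDerivAt σ (A : E →L[ℝ] E) p := by
    rw [hA]; exact (hσp.differentiableAt (by simp)).hasFDerivAt
  set H := hσp.toOpenPartialHomeomorph σ hder (by simp) with hH
  have hHc : (H : E → E) = σ := rfl
  have hpH : p ∈ H.source := hσp.mem_toOpenPartialHomeomorph_source hder (by simp)
  set R₂ : Set E := R₁ ∩ fderiv ℝ σ ⁻¹' (range ((↑) : (E ≃L[ℝ] E) → E →L[ℝ] E)) with hR₂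
  have hR₂o : IsOpen R₂ :=
    (hσd.continuousOn_fderiv_of_isOpen hR₁o (by simp)).isOpen_inter_preimage hR₁o
      ContinuousLinearEquiv.isOpen
  set R₃ : Set E := R₂ ∩ σ ⁻¹' R' with hR₃
  have hR₃o : IsOpen R₃ :=
    ((hσd.continuousOn).mono inter_subset_left).isOpen_inter_preimage hR₂o hR'
  set W := H.source ∩ R₃ with hW
  have hWo : IsOpen W := H.open_source.inter hR₃o
  have hW' : IsOpen (H '' W) := H.isOpen_image_of_subset_source hWo inter_subset_left
  refine ⟨W, H '' W, fun q => (Φ (H.symm q, f (H.symm q))).2, hWo, hW',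
    ⟨hpH, ⟨hpR₁, A, hA⟩, hpR'⟩, fun q hq => hq.2.1.1.1, ?_, ?_, ?_, ?_⟩
  · rintro _ ⟨q, hq, rfl⟩
    exact hq.2.2
  · rintro _ ⟨q, hq, rfl⟩
    obtain ⟨B, hB⟩ := hq.2.1.2
    have hs : H.symm (H q) = q := H.left_inv hq.1
    have hq1 : R₁ ∈ 𝓝 q := hR₁o.mem_nhds hq.2.1.1
    have h1 : ContDiffAt ℝ ∞ H.symm (H q) := by
      refine H.contDiffAt_symm (f₀' := B) (H.map_source hq.1) ?_ ?_
      · rw [hs, hHc, hB]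
        exact ((hσd.contDiffAt hq1).differentiableAt (by simp)).hasFDerivAt
      · rw [hs, hHc]; exact hσd.contDiffAt hq1
    have h2 : ContDiffAt ℝ ∞ (fun q => Φ (q, f q)) (H.symm (H q)) := by
      rw [hs]; exact hΦf.contDiffAt hq1
    exact (h2.comp (H q) h1).snd.contDiffWithinAt
  · rintro _ ⟨q, hq, rfl⟩
    exact hq.2.1.1.2
  · ext z
    simp only [graphOn, image_image, mem_image]
    constructor
    · rintro ⟨q, hq, rfl⟩
      refine ⟨q, hq, ?_⟩
      rw [H.left_inv hq.1]
      rfl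
    · rintro ⟨q, hq, rfl⟩
      refine ⟨q, hq, ?_⟩
      rw [H.left_inv hq.1]
      rfl

end Calculus

/-- The jet relations for the transform of a solution of an equation of the class. -/
theorem exists_transformed_jet {U : Set Vars} (hU : IsOpen U) {Φ : Vars → Vars}
    (hΦ : ContDiffOn ℝ ∞ Φ U) {θ θ' : Params} (hM : MapsEquation U Φ θ θ') {f : Base → ℝ}
    (hf : ContDiffOn ℝ ∞ f (regularSet θ)) (hs : Solves θ f (regularSet θ)) {p : Base}
    (hp : p ∈ regularSet θ) (hpU : (p, f p) ∈ U) (hp' : (Φ (p, f p)).1 ∈ regularSet θ')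
    (htr : ∀ e, (fderiv ℝ Φ (p, f p) (e, fderiv ℝ f p e)).1 = 0 → e = 0) :
    ∃ (l : Base →L[ℝ] ℝ) (Q : Base →L[ℝ] Base →L[ℝ] ℝ),
      (∀ e, l (fderiv ℝ Φ (p, f p) (e, fderiv ℝ f p e)).1 =
        (fderiv ℝ Φ (p, f p) (e, fderiv ℝ f p e)).2) ∧
      (∀ e, Q (fderiv ℝ Φ (p, f p) (e, fderiv ℝ f p e)).1
          (fderiv ℝ Φ (p, f p) (e, fderiv ℝ f p e)).1 +
        l (fderiv ℝ (fderiv ℝ Φ) (p, f p) (e, fderiv ℝ f p e) (e, fderiv ℝ f p e) +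
          fderiv ℝ Φ (p, f p) (0, fderiv ℝ (fderiv ℝ f) p e e)).1 =
        (fderiv ℝ (fderiv ℝ Φ) (p, f p) (e, fderiv ℝ f p e) (e, fderiv ℝ f p e) +
          fderiv ℝ Φ (p, f p) (0, fderiv ℝ (fderiv ℝ f) p e e)).2) ∧
      l (1, 0, 0) + (Φ (p, f p)).1.2.1 * l (0, 0, 1) =
        |(Φ (p, f p)).1.2.1 - θ'.1| ^ θ'.2 * Q (0, 1, 0) (0, 1, 0) := by
  have hreg : ∀ θ : Params, IsOpen (regularSet θ) := fun θ =>
    isOpen_ne_fun (by fun_prop) continuous_const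
  obtain ⟨W, W', f', hW, hW', hpW, hWR, hWR', hf', hg, him⟩ :=
    exists_graph_image hU hΦ (hreg θ) (hreg θ') hf hp hpU hp' htr
  have hmem : ∀ q ∈ W, (Φ (q, f q)).1 ∈ W' ∧ f' (Φ (q, f q)).1 = (Φ (q, f q)).2 := by
    intro q hq
    have : Φ (q, f q) ∈ W'.graphOn f' := him ▸ mem_image_of_mem Φ (mem_image_of_mem _ hq)
    obtain ⟨q', hq', h⟩ := this
    rw [← h]
    exact ⟨hq', rfl⟩
  have hsol : Solves θ' f' W' :=
    (hM W W' f f' ⟨hW, hWR, hf.mono hWR⟩ ⟨hW', hWR', hf'⟩ hg him).1 fun q hq => hs q (hWR hq)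
  have hfa : ContDiffAt ℝ ∞ f' (Φ (p, f p)).1 := hf'.contDiffAt (hW'.mem_nhds (hmem p hpW).1)
  have hj := jet_relations (hΦ.contDiffAt (hU.mem_nhds hpU))
    (hf.contDiffAt ((hreg θ).mem_nhds hp)) hfa
    (eventually_of_mem (hW.mem_nhds hpW) fun q hq => (hmem q hq).2)
  refine ⟨fderiv ℝ f' (Φ (p, f p)).1, fderiv ℝ (fderiv ℝ f') (Φ (p, f p)).1,
    fun e => (hj e).1, fun e => (hj e).2, ?_⟩
  have h1 := hsol _ (hmem p hpW).1
  have h2 : dx (dx f') (Φ (p, f p)).1 =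
      fderiv ℝ (fderiv ℝ f') (Φ (p, f p)).1 (0, 1, 0) (0, 1, 0) := by
    have hd : DifferentiableAt ℝ (fderiv ℝ f') (Φ (p, f p)).1 :=
      (hfa.fderiv_right (m := 1) (by norm_cast)).differentiableAt (by simp)
    have h3 := hd.hasFDerivAt.clm_apply (hasFDerivAt_const ((0, 1, 0) : Base) _)
    unfold dx
    rw [h3.fderiv]
    simp
  rw [h2] at h1
  exact h1

/-- The covector with the components `a`, `b` and `c`. -/
noncomputable def covector (a b c : ℝ) : Base →L[ℝ] ℝ :=
  a • ContinuousLinearMap.fst ℝ ℝ (ℝ × ℝ) +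
    b • (ContinuousLinearMap.fst ℝ ℝ ℝ).comp (ContinuousLinearMap.snd ℝ ℝ (ℝ × ℝ)) +
    c • (ContinuousLinearMap.snd ℝ ℝ ℝ).comp (ContinuousLinearMap.snd ℝ ℝ (ℝ × ℝ))

@[simp]
theorem covector_apply (a b c : ℝ) (e : Base) :
    covector a b c e = a * e.1 + b * e.2.1 + c * e.2.2 := by
  simp [covector]

/-- A polynomial in `t - t₀` and `y - y₀` with coefficients depending on `x`. -/
noncomputable def quadraticAnsatz (A B C : ℝ → ℝ) (t₀ y₀ s r : ℝ) (q : Base) : ℝ :=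
  A q.2.1 + (q.1 - t₀) * B q.2.1 + (q.2.2 - y₀) * C q.2.1 +
    (s * (q.1 - t₀) ^ 2 + r * (q.2.2 - y₀) ^ 2) / 2

theorem hasFDerivAt_quadraticAnsatz {A B C : ℝ → ℝ} {a b c : ℝ} {q : Base}
    (hA : HasDerivAt A a q.2.1) (hB : HasDerivAt B b q.2.1) (hC : HasDerivAt C c q.2.1)
    (t₀ y₀ s r : ℝ) :
    HasFDerivAt (quadraticAnsatz A B C t₀ y₀ s r)
      (covector (B q.2.1 + s * (q.1 - t₀)) (a + (q.1 - t₀) * b + (q.2.2 - y₀) * c)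
        (C q.2.1 + r * (q.2.2 - y₀))) q := by
  have ht : HasFDerivAt (fun q : Base => q.1) (ContinuousLinearMap.fst ℝ ℝ (ℝ × ℝ)) q :=
    hasFDerivAt_fst
  have h2 : HasFDerivAt (fun q : Base => q.2) (ContinuousLinearMap.snd ℝ ℝ (ℝ × ℝ)) q :=
    hasFDerivAt_snd
  have hx := h2.fst
  have hy := h2.snd
  have hA' : HasFDerivAt (fun q : Base => A q.2.1) _ q := hA.comp_hasFDerivAt q hx
  have hB' : HasFDerivAt (fun q : Base => B q.2.1) _ q := hB.comp_hasFDerivAt q hx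
  have hC' : HasFDerivAt (fun q : Base => C q.2.1) _ q := hC.comp_hasFDerivAt q hx
  have ht' := ht.sub_const t₀
  have hy' := hy.sub_const y₀
  have key := ((hA'.add (ht'.mul hB')).add (hy'.mul hC')).add
    ((((ht'.pow 2).const_mul s).add ((hy'.pow 2).const_mul r)).mul_const (1 / 2))
  refine (key.congr_fderiv ?_).congr_of_eventuallyEq (Eventually.of_forall fun q => ?_)
  · ext <;> simp <;> ring
  · simp [quadraticAnsatz]; ring

/-- Solutions quadratic in `(t, y)`. -/
theorem exists_quadratic_solution {θ : Params} {A A₁ A₂ B B₁ B₂ C C₁ C₂ : ℝ → ℝ} {s r : ℝ}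
    (hA : ∀ x ≠ θ.1, HasDerivAt A (A₁ x) x) (hA₁ : ∀ x ≠ θ.1, HasDerivAt A₁ (A₂ x) x)
    (hB : ∀ x ≠ θ.1, HasDerivAt B (B₁ x) x) (hB₁ : ∀ x ≠ θ.1, HasDerivAt B₁ (B₂ x) x)
    (hC : ∀ x ≠ θ.1, HasDerivAt C (C₁ x) x) (hC₁ : ∀ x ≠ θ.1, HasDerivAt C₁ (C₂ x) x)
    (hAs : ContDiffOn ℝ ∞ A {θ.1}ᶜ) (hBs : ContDiffOn ℝ ∞ B {θ.1}ᶜ)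
    (hCs : ContDiffOn ℝ ∞ C {θ.1}ᶜ)
    (hABC : ∀ x ≠ θ.1, B x + x * C x = |x - θ.1| ^ θ.2 * A₂ x)
    (hBB : ∀ x ≠ θ.1, s = |x - θ.1| ^ θ.2 * B₂ x)
    (hCC : ∀ x ≠ θ.1, x * r = |x - θ.1| ^ θ.2 * C₂ x)
    {p : Base} (hp : p ∈ regularSet θ) (hB0 : B₁ p.2.1 = 0) (hC0 : C₁ p.2.1 = 0) :
    ∃ f : Base → ℝ, ContDiffOn ℝ ∞ f (regularSet θ) ∧ Solves θ f (regularSet θ) ∧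
      f p = A p.2.1 ∧ fderiv ℝ f p = covector (B p.2.1) (A₁ p.2.1) (C p.2.1) ∧
      ∀ e, fderiv ℝ (fderiv ℝ f) p e e =
        A₂ p.2.1 * e.2.1 ^ 2 + s * e.1 ^ 2 + r * e.2.2 ^ 2 := by
  have hreg : IsOpen (regularSet θ) := isOpen_ne_fun (by fun_prop) continuous_const
  set f := quadraticAnsatz A B C p.1 p.2.2 s r with hf
  set fx := quadraticAnsatz A₁ B₁ C₁ p.1 p.2.2 0 0 with hfx
  have hd : ∀ q ∈ regularSet θ, HasFDerivAt f
      (covector (B q.2.1 + s * (q.1 - p.1)) (fx q) (C q.2.1 + r * (q.2.2 - p.2.2))) q := by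
    intro q hq
    convert hasFDerivAt_quadraticAnsatz (hA _ hq) (hB _ hq) (hC _ hq) p.1 p.2.2 s r using 2
    simp [hfx, quadraticAnsatz]
  have hdx : ∀ q ∈ regularSet θ, HasFDerivAt fx
      (covector (B₁ q.2.1) (A₂ q.2.1 + (q.1 - p.1) * B₂ q.2.1 + (q.2.2 - p.2.2) * C₂ q.2.1)
        (C₁ q.2.1)) q := by
    intro q hq
    convert hasFDerivAt_quadraticAnsatz (hA₁ _ hq) (hB₁ _ hq) (hC₁ _ hq) p.1 p.2.2 0 0 using 2
      <;> simp
  have hfs : ContDiffOn ℝ ∞ f (regularSet θ) := by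
    have hx : ContDiffOn ℝ ∞ (fun q : Base => q.2.1) (regularSet θ) := by fun_prop
    have h1 := hAs.comp hx fun q hq => hq
    have h2 := hBs.comp hx fun q hq => hq
    have h3 := hCs.comp hx fun q hq => hq
    simp only [Function.comp_def] at h1 h2 h3
    have ht : ContDiffOn ℝ ∞ (fun q : Base => q.1 - p.1) (regularSet θ) := by fun_prop
    have hy : ContDiffOn ℝ ∞ (fun q : Base => q.2.2 - p.2.2) (regularSet θ) := by fun_prop
    exact ((h1.add (ht.mul h2)).add (hy.mul h3)).add
      (((contDiffOn_const.mul (ht.pow 2)).add (contDiffOn_const.mul (hy.pow 2))).div_const 2)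
  refine ⟨f, hfs, ?_, by simp [hf, quadraticAnsatz], ?_, ?_⟩
  · intro q hq
    have e1 : dx (dx f) q = fderiv ℝ fx q (0, 1, 0) := by
      unfold dx
      have : (fun q => fderiv ℝ f q (0, 1, 0)) =ᶠ[𝓝 q] fx := by
        filter_upwards [hreg.mem_nhds hq] with w hw
        simp [(hd w hw).fderiv]
      rw [this.fderiv_eq]
    rw [e1, (hdx q hq).fderiv, dt, dy, (hd q hq).fderiv]
    simp only [covector_apply]
    linear_combination hABC _ hq + (q.1 - p.1) * hBB _ hq + (q.2.2 - p.2.2) * hCC _ hq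
  · rw [(hd p hp).fderiv]
    simp [hfx, quadraticAnsatz]
  · intro e
    have h1 : fderiv ℝ (fderiv ℝ f) p e e = fderiv ℝ (fun q => fderiv ℝ f q e) p e := by
      have hdd : DifferentiableAt ℝ (fderiv ℝ f) p :=
        ((hfs.contDiffAt (hreg.mem_nhds hp)).fderiv_right (m := 1)
          (by norm_cast)).differentiableAt (by simp)
      rw [(hdd.hasFDerivAt.clm_apply (hasFDerivAt_const e p)).fderiv]
      simp
    have h2 : (fun q => fderiv ℝ f q e) =ᶠ[𝓝 p] fun q =>
        e.2.1 * fx q + quadraticAnsatz (fun x => e.1 * B x + e.2.2 * C x) (fun _ => e.1 * s)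
          (fun _ => e.2.2 * r) p.1 p.2.2 0 0 q := by
      filter_upwards [hreg.mem_nhds hp] with w hw
      rw [(hd w hw).fderiv]
      simp [quadraticAnsatz]; ring
    have h3 := hasFDerivAt_quadraticAnsatz (A := fun x => e.1 * B x + e.2.2 * C x)
      (B := fun _ => e.1 * s) (C := fun _ => e.2.2 * r)
      (((hB _ hp).const_mul e.1).add ((hC _ hp).const_mul e.2.2)) (hasDerivAt_const _ _)
      (hasDerivAt_const _ _) p.1 p.2.2 0 0
    rw [h1, h2.fderiv_eq, (((hdx p hp).const_mul e.2.1).fun_add h3).fderiv]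
    simp [hB0, hC0]; ring

/-- Solutions for `β = 0` with prescribed jets. -/
theorem exists_solution_zero (α : ℝ) {p : Base} (hp : p.2.1 ≠ α) (u a b c s r : ℝ) :
    ∃ f : Base → ℝ, ContDiffOn ℝ ∞ f (regularSet (α, 0)) ∧
      Solves (α, 0) f (regularSet (α, 0)) ∧ f p = u ∧ fderiv ℝ f p = covector a b c ∧
      ∀ e, fderiv ℝ (fderiv ℝ f) p e e =
        (a + c * p.2.1) * e.2.1 ^ 2 + s * e.1 ^ 2 + r * e.2.2 ^ 2 := by
  obtain ⟨t₀, x₀, y₀⟩ := p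
  have key : ∀ x : ℝ, ∀ n : ℕ, HasDerivAt (fun x => (x - x₀) ^ (n + 1))
      ((n + 1) * (x - x₀) ^ n) x := fun x n => by
    simpa using ((hasDerivAt_id x).sub_const x₀).fun_pow (n + 1)
  have h1 := fun x => key x 0
  have h2 := fun x => key x 1
  have h3 := fun x => key x 2
  have h4 := fun x => key x 3
  have h5 := fun x => key x 4
  have h6 := fun x => key x 5
  obtain ⟨f, f1, f2, f3, f4, f5⟩ := exists_quadratic_solution (θ := (α, 0)) (s := s) (r := r)
    (p := (t₀, x₀, y₀))
    (A := fun x => u + (b * (x - x₀) ^ (0 + 1) + ((a + c * x₀) / 2 * (x - x₀) ^ (1 + 1) +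
      (c / 6 * (x - x₀) ^ (2 + 1) + ((s + r * x₀ ^ 2) / 24 * (x - x₀) ^ (3 + 1) +
      (r * x₀ / 30 * (x - x₀) ^ (4 + 1) + r / 180 * (x - x₀) ^ (5 + 1)))))))
    (A₁ := fun x => b + ((a + c * x₀) * (x - x₀) ^ (0 + 1) +
      (c / 2 * (x - x₀) ^ (1 + 1) + ((s + r * x₀ ^ 2) / 6 * (x - x₀) ^ (2 + 1) +
      (r * x₀ / 6 * (x - x₀) ^ (3 + 1) + r / 30 * (x - x₀) ^ (4 + 1))))))
    (A₂ := fun x => a + c * x₀ + c * (x - x₀) + (s + r * x₀ ^ 2) / 2 * (x - x₀) ^ 2 +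
      2 * (r * x₀) / 3 * (x - x₀) ^ 3 + r / 6 * (x - x₀) ^ 4)
    (B := fun x => a + s / 2 * (x - x₀) ^ (1 + 1)) (B₁ := fun x => s * (x - x₀) ^ (0 + 1))
    (B₂ := fun _ => s)
    (C := fun x => c + (r * x₀ / 2 * (x - x₀) ^ (1 + 1) + r / 6 * (x - x₀) ^ (2 + 1)))
    (C₁ := fun x => r * x₀ * (x - x₀) ^ (0 + 1) + r / 2 * (x - x₀) ^ (1 + 1))
    (C₂ := fun x => r * x₀ + r * (x - x₀))
    (fun x _ => by
      refine HasDerivAt.congr_deriv ((((h1 x).const_mul b).add (((h2 x).const_mul _).add (((h3 x).const_mul _).add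
        (((h4 x).const_mul _).add (((h5 x).const_mul _).add ((h6 x).const_mul _)))))).const_add u) ?_
      push_cast; ring)
    (fun x _ => by
      refine HasDerivAt.congr_deriv ((((h1 x).const_mul (a + c * x₀)).add (((h2 x).const_mul _).add
        (((h3 x).const_mul _).add (((h4 x).const_mul _).add ((h5 x).const_mul _))))).const_add b) ?_
      push_cast; ring)
    (fun x _ => by
      refine HasDerivAt.congr_deriv (((h2 x).const_mul (s / 2)).const_add a) ?_
      push_cast; ring)
    (fun x _ => by
      refine HasDerivAt.congr_deriv ((h1 x).const_mul s) ?_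
      push_cast; ring)
    (fun x _ => by
      refine HasDerivAt.congr_deriv ((((h2 x).const_mul (r * x₀ / 2)).add ((h3 x).const_mul (r / 6))).const_add c) ?_
      push_cast; ring)
    (fun x _ => by
      refine HasDerivAt.congr_deriv (((h1 x).const_mul (r * x₀)).add ((h2 x).const_mul (r / 2))) ?_
      push_cast; ring)
    (by fun_prop) (by fun_prop) (by fun_prop)
    (fun x _ => by simp; ring) (fun x _ => by simp) (fun x _ => by simp; ring)
    hp (by simp) (by simp)
  refine ⟨f, f1, f2, by simpa using f3, by simpa using f4, fun e => ?_⟩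
  rw [f5 e]
  simp

/-- Solutions affine in `t` with prescribed jets. -/
theorem exists_solution {θ : Params} (h₁ : θ.2 ≠ 1) (h₂ : θ.2 ≠ 2) {p : Base}
    (hp : p.2.1 ≠ θ.1) (u a b : ℝ) :
    ∃ f : Base → ℝ, ContDiffOn ℝ ∞ f (regularSet θ) ∧
      Solves θ f (regularSet θ) ∧ f p = u ∧ fderiv ℝ f p = covector a b 0 ∧
      ∀ e, |p.2.1 - θ.1| ^ θ.2 * fderiv ℝ (fderiv ℝ f) p e e = a * e.2.1 ^ 2 := by
  obtain ⟨t₀, x₀, y₀⟩ := p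
  obtain ⟨α, β⟩ := θ
  simp only at h₁ h₂ hp ⊢
  have h₁' : 1 - β ≠ 0 := sub_ne_zero.2 h₁.symm
  have h₂' : 2 - β ≠ 0 := sub_ne_zero.2 h₂.symm
  set E : ℝ → ℝ := fun x => Real.exp ((2 - β) * Real.log (x - α)) with hE
  have hEd : ∀ x ≠ α, HasDerivAt E (E x * ((2 - β) * (1 / (x - α)))) x := fun x hx => by
    simpa [hE] using ((((hasDerivAt_id x).sub_const α).log (sub_ne_zero.2 hx)).const_mul
      (2 - β)).exp
  have hEs : ContDiffOn ℝ ∞ E {α}ᶜ := by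
    have : ContDiffOn ℝ ∞ (fun x => Real.log (x - α)) {α}ᶜ :=
      ContDiffOn.log (by fun_prop) fun x hx => sub_ne_zero.2 hx
    unfold E
    fun_prop
  have hEK : ∀ x ≠ α, |x - α| ^ β * (E x / (x - α) ^ 2) = 1 := fun x hx => by
    have hw : x - α ≠ 0 := sub_ne_zero.2 hx
    have h0 : 0 < |x - α| := abs_pos.2 hw
    have : E x = |x - α| ^ (2 - β) := by
      simp only [hE]
      rw [Real.rpow_def_of_pos h0, Real.log_abs, mul_comm]
    rw [this, Real.rpow_sub h0, ← sq_abs (x - α)]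
    have := (Real.rpow_pos_of_pos h0 β).ne'
    simp only [Real.rpow_two]
    field_simp
  set k := E x₀ / (x₀ - α) / (1 - β) with hk
  obtain ⟨f, f1, f2, f3, f4, f5⟩ := exists_quadratic_solution (θ := (α, β)) (s := 0) (r := 0)
    (p := (t₀, x₀, y₀))
    (A := fun x => (u - a * (E x₀ / ((1 - β) * (2 - β)))) +
      ((b - a * k) * (x - x₀) + a / ((1 - β) * (2 - β)) * E x))
    (A₁ := fun x => (b - a * k) + a / (1 - β) * (E x / (x - α)))
    (A₂ := fun x => a * (E x / (x - α) ^ 2))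
    (B := fun x => a) (B₁ := fun x => 0) (B₂ := fun _ => 0)
    (C := fun x => 0) (C₁ := fun x => 0) (C₂ := fun x => 0)
    (fun x hx => by
      have hw : x - α ≠ 0 := sub_ne_zero.2 hx
      refine HasDerivAt.congr_deriv (((((hasDerivAt_id x).sub_const x₀).const_mul (b - a * k)).add
        ((hEd x hx).const_mul (a / ((1 - β) * (2 - β))))).const_add _) ?_
      field_simp)
    (fun x hx => by
      have hw : x - α ≠ 0 := sub_ne_zero.2 hx
      refine HasDerivAt.congr_deriv ((((hEd x hx).div ((hasDerivAt_id x).sub_const α) hw).const_mul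
        (a / (1 - β))).const_add _) ?_
      simp only [id]
      field_simp
      ring)
    (fun x _ => hasDerivAt_const _ _) (fun x _ => hasDerivAt_const _ _)
    (fun x _ => hasDerivAt_const _ _) (fun x _ => hasDerivAt_const _ _)
    (by fun_prop) (by fun_prop) (by fun_prop)
    (fun x hx => by linear_combination -a * hEK x hx) (fun x _ => by simp) (fun x _ => by simp)
    hp rfl rfl
  refine ⟨f, f1, f2, ?_, ?_, fun e => ?_⟩
  · rw [f3]; simp; ring
  · rw [f4]; congr 1; simp only [hk]; ring
  · rw [f5 e]
    simp only
    linear_combination a * e.2.1 ^ 2 * hEK x₀ hp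

section Jets

variable {U : Set Vars} {Φ : Vars → Vars} {z : Vars}

theorem exists_transformed_jet_zero (hU : IsOpen U) (hΦ : ContDiffOn ℝ ∞ Φ U) {α : ℝ}
    {θ' : Params} (hM : MapsEquation U Φ (α, 0) θ') (hz : z ∈ U) (hα : z.1.2.1 ≠ α)
    (hα' : (Φ z).1.2.1 ≠ θ'.1) (a b c s r : ℝ)
    (htr : ∀ e, (fderiv ℝ Φ z (e, covector a b c e)).1 = 0 → e = 0) :
    ∃ (l : Base →L[ℝ] ℝ) (Q : Base →L[ℝ] Base →L[ℝ] ℝ),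
      (∀ e, l (fderiv ℝ Φ z (e, covector a b c e)).1 =
        (fderiv ℝ Φ z (e, covector a b c e)).2) ∧
      (∀ e, Q (fderiv ℝ Φ z (e, covector a b c e)).1 (fderiv ℝ Φ z (e, covector a b c e)).1 +
        l (fderiv ℝ (fderiv ℝ Φ) z (e, covector a b c e) (e, covector a b c e) +
          fderiv ℝ Φ z
            (0, (a + c * z.1.2.1) * e.2.1 ^ 2 + s * e.1 ^ 2 + r * e.2.2 ^ 2)).1 =
        (fderiv ℝ (fderiv ℝ Φ) z (e, covector a b c e) (e, covector a b c e) +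
          fderiv ℝ Φ z
            (0, (a + c * z.1.2.1) * e.2.1 ^ 2 + s * e.1 ^ 2 + r * e.2.2 ^ 2)).2) ∧
      l (1, 0, 0) + (Φ z).1.2.1 * l (0, 0, 1) =
        |(Φ z).1.2.1 - θ'.1| ^ θ'.2 * Q (0, 1, 0) (0, 1, 0) := by
  obtain ⟨p, u⟩ := z
  obtain ⟨f, f1, f2, rfl, f4, f5⟩ := exists_solution_zero (p := p) α hα u a b c s r
  have := exists_transformed_jet hU hΦ hM f1 f2 hα hz hα' (by rwa [f4])
  simpa only [f4, f5] using this

theorem exists_transformed_jet_general (hU : IsOpen U) (hΦ : ContDiffOn ℝ ∞ Φ U)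
    {θ θ' : Params} (hM : MapsEquation U Φ θ θ') (h₁ : θ.2 ≠ 1) (h₂ : θ.2 ≠ 2)
    (hz : z ∈ U) (hα : z.1.2.1 ≠ θ.1) (hα' : (Φ z).1.2.1 ≠ θ'.1) (a b : ℝ)
    (htr : ∀ e, (fderiv ℝ Φ z (e, covector a b 0 e)).1 = 0 → e = 0) :
    ∃ (l : Base →L[ℝ] ℝ) (Q : Base →L[ℝ] Base →L[ℝ] ℝ) (S : ℝ),
      |z.1.2.1 - θ.1| ^ θ.2 * S = a ∧
      (∀ e, l (fderiv ℝ Φ z (e, covector a b 0 e)).1 =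
        (fderiv ℝ Φ z (e, covector a b 0 e)).2) ∧
      (Q (fderiv ℝ Φ z ((0, 1, 0), b)).1 (fderiv ℝ Φ z ((0, 1, 0), b)).1 +
        l (fderiv ℝ (fderiv ℝ Φ) z ((0, 1, 0), b) ((0, 1, 0), b) + fderiv ℝ Φ z (0, S)).1 =
        (fderiv ℝ (fderiv ℝ Φ) z ((0, 1, 0), b) ((0, 1, 0), b) + fderiv ℝ Φ z (0, S)).2) ∧
      l (1, 0, 0) + (Φ z).1.2.1 * l (0, 0, 1) =
        |(Φ z).1.2.1 - θ'.1| ^ θ'.2 * Q (0, 1, 0) (0, 1, 0) := by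
  obtain ⟨p, u⟩ := z
  obtain ⟨f, f1, f2, rfl, f4, f5⟩ := exists_solution (p := p) h₁ h₂ hα u a b
  obtain ⟨l, Q, i, ii, iii⟩ := exists_transformed_jet hU hΦ hM f1 f2 hα hz hα' (by rwa [f4])
  refine ⟨l, Q, fderiv ℝ (fderiv ℝ f) p (0, 1, 0) (0, 1, 0), by simpa using f5 (0, 1, 0),
    by simpa only [f4] using i, ?_, iii⟩
  simpa [f4] using ii (0, 1, 0)

/-- The images of transversal lifts of `∂/∂x` are proportional to `∂/∂x`. -/
theorem fderiv_transversal_lift (hU : IsOpen U) (hΦ : ContDiffOn ℝ ∞ Φ U)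
    (hinj : Function.Injective (fderiv ℝ Φ z)) {α : ℝ}
    {θ' : Params} (hM : MapsEquation U Φ (α, 0) θ') (hz : z ∈ U) (hα : z.1.2.1 ≠ α)
    (hα' : (Φ z).1.2.1 ≠ θ'.1) {a b c : ℝ}
    (htr : ∀ e, (fderiv ℝ Φ z (e, covector a b c e)).1 = 0 → e = 0) :
    (fderiv ℝ Φ z ((0, 1, 0), b)).1.1 = 0 ∧ (fderiv ℝ Φ z ((0, 1, 0), b)).1.2.2 = 0 := by
  obtain ⟨l₀, Q₀, i₀, ii₀, iii₀⟩ := exists_transformed_jet_zero hU hΦ hM hz hα hα' a b c 0 0 htr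
  set L := fderiv ℝ Φ z with hL
  have hsurj : Function.Surjective L :=
    (LinearMap.injective_iff_surjective (f := (L : Vars →ₗ[ℝ] Vars))).1 hinj
  set J : Base →L[ℝ] Base := (ContinuousLinearMap.fst ℝ Base ℝ).comp
    (L.comp ((ContinuousLinearMap.id ℝ Base).prod (covector a b c))) with hJ
  have hJe : ∀ e, J e = (L (e, covector a b c e)).1 := fun e => rfl
  have hJs : Function.Surjective J := by
    refine (LinearMap.injective_iff_surjective (f := (J : Base →ₗ[ℝ] Base))).1 ?_
    rw [← LinearMap.ker_eq_bot, LinearMap.ker_eq_bot']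
    exact htr
  obtain ⟨e, he⟩ := hJs (0, 1, 0)
  have hA : 0 < |(Φ z).1.2.1 - θ'.1| ^ θ'.2 :=
    Real.rpow_pos_of_pos (abs_pos.2 (sub_ne_zero.2 hα')) _
  have main : ∀ s r : ℝ, s * e.1 ^ 2 + r * e.2.2 ^ 2 = 0 := by
    intro s r
    obtain ⟨l, Q, i, ii, iii⟩ := exists_transformed_jet_zero hU hΦ hM hz hα hα' a b c s r htr
    rw [← hL] at i ii
    have hl : l = l₀ := by
      refine ContinuousLinearMap.ext fun w => ?_
      obtain ⟨w', rfl⟩ := hJs w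
      rw [hJe, i, i₀]
    subst hl
    have hQ : Q (0, 1, 0) (0, 1, 0) = Q₀ (0, 1, 0) (0, 1, 0) :=
      mul_left_cancel₀ hA.ne' (iii.symm.trans iii₀)
    have h1 := ii e
    have h0 := ii₀ e
    rw [← hJe, he] at h1 h0
    by_contra hne
    set k := s * e.1 ^ 2 + r * e.2.2 ^ 2 with hk
    have hsplit : L (0, (a + c * z.1.2.1) * e.2.1 ^ 2 + s * e.1 ^ 2 + r * e.2.2 ^ 2) =
        L (0, (a + c * z.1.2.1) * e.2.1 ^ 2 + 0 * e.1 ^ 2 + 0 * e.2.2 ^ 2) + k • L (0, 1) := by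
      rw [← map_smul, ← map_add]
      congr 1
      ext <;> simp [hk]
      ring
    rw [hsplit] at h1
    simp only [Prod.fst_add, Prod.snd_add, Prod.smul_fst, Prod.smul_snd, map_add, map_smul,
      smul_eq_mul] at h1 h0
    have hu : l (L (0, 1)).1 = (L (0, 1)).2 := by
      apply mul_left_cancel₀ hne
      linarith
    have hall : ∀ v, l (L v).1 = (L v).2 := by
      intro v
      have hv : v = (v.1, covector a b c v.1) + (v.2 - covector a b c v.1) • (0, 1) := by
        ext <;> simp
      have := i v.1
      rw [hv, map_add, map_smul]
      simp only [Prod.fst_add, Prod.snd_add, Prod.smul_fst, Prod.smul_snd, map_add, map_smul,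
        smul_eq_mul, hu]
      rw [this]
    obtain ⟨v, hv⟩ := hsurj (0, 1)
    have := hall v
    rw [hv] at this
    simp at this
  have e1 : e.1 = 0 := by simpa using main 1 0
  have e3 : e.2.2 = 0 := by simpa using main 0 1
  have hee : e = e.2.1 • (0, 1, 0) := by ext <;> simp [e1, e3]
  have h2 : e.2.1 • (L ((0, 1, 0), b)).1 = (0, 1, 0) := by
    rw [hee, map_smul, hJe] at he
    simpa using he
  have hne : e.2.1 ≠ 0 := by
    intro h
    rw [h, zero_smul] at h2
    simpa using congrArg (fun w : Base => w.2.1) h2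
  constructor
  · have := congrArg (fun w : Base => w.1) h2
    simpa [hne] using this
  · have := congrArg (fun w : Base => w.2.2) h2
    simpa [hne] using this

theorem fderiv_x_u_of_mapsEquation (hU : IsOpen U) (hΦ : ContDiffOn ℝ ∞ Φ U)
    (hinj : Function.Injective (fderiv ℝ Φ z)) {α : ℝ}
    {θ' : Params} (hM : MapsEquation U Φ (α, 0) θ') (hz : z ∈ U) (hα : z.1.2.1 ≠ α)
    (hα' : (Φ z).1.2.1 ≠ θ'.1) :
    ((fderiv ℝ Φ z ((0, 1, 0), 0)).1.1 = 0 ∧ (fderiv ℝ Φ z ((0, 1, 0), 0)).1.2.2 = 0) ∧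
    ((fderiv ℝ Φ z (0, 1)).1.1 = 0 ∧ (fderiv ℝ Φ z (0, 1)).1.2.2 = 0) := by
  have hsurj : Function.Surjective (fderiv ℝ Φ z) :=
    (LinearMap.injective_iff_surjective (f := (fderiv ℝ Φ z : Vars →ₗ[ℝ] Vars))).1 hinj
  obtain ⟨k, hk⟩ := hsurj (0, 1)
  have hk0 : k ≠ 0 := by
    rintro rfl
    simpa using congrArg Prod.snd hk
  have htr : ∀ a b c : ℝ, k.2 ≠ covector a b c k.1 → ∀ e,
      (fderiv ℝ Φ z (e, covector a b c e)).1 = 0 → e = 0 := by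
    intro a b c h e he
    set m := (fderiv ℝ Φ z (e, covector a b c e)).2 with hm
    have h1 : fderiv ℝ Φ z (e, covector a b c e) = fderiv ℝ Φ z (m • k) := by
      rw [map_smul, hk]
      ext1
      · simpa using he
      · simp [hm]
    have h2 := hinj h1
    have h3 : e = m • k.1 := congrArg Prod.fst h2
    have h4 : covector a b c e = m * k.2 := congrArg Prod.snd h2
    rw [h3, map_smul, smul_eq_mul] at h4
    have : m = 0 := by
      by_contra hm0
      exact h (mul_left_cancel₀ hm0 h4).symm
    rw [h3, this, zero_smul]
  have hex : ∃ a b c a' b' c' : ℝ, b ≠ b' ∧ k.2 ≠ covector a b c k.1 ∧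
      k.2 ≠ covector a' b' c' k.1 := by
    obtain ⟨⟨k1, k2, k3⟩, k4⟩ := k
    simp only [covector_apply]
    by_cases h1 : k1 = 0
    · by_cases h3 : k3 = 0
      · by_cases h2 : k2 = 0
        · refine ⟨0, 0, 0, 0, 1, 0, by simp, ?_⟩
          subst h1 h2 h3
          simpa using hk0
        · refine ⟨0, (k4 + 1) / k2, 0, 0, (k4 + 2) / k2, 0, ?_, ?_, ?_⟩
          · intro h
            field_simp at h
            linarith
          · field_simp
            simp
          · field_simp
            simp
      · refine ⟨0, 0, (k4 + 1) / k3, 0, 1, (k4 - k2 + 1) / k3, by simp, ?_, ?_⟩ <;>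
        · field_simp
          intro h
          linarith
    · refine ⟨(k4 + 1) / k1, 0, 0, (k4 - k2 + 1) / k1, 1, 0, by simp, ?_, ?_⟩ <;>
      · field_simp
        intro h
        linarith
  obtain ⟨a, b, c, a', b', c', hb, h1, h2⟩ := hex
  obtain ⟨t1, y1⟩ := fderiv_transversal_lift hU hΦ hinj hM hz hα hα' (htr _ _ _ h1)
  obtain ⟨t2, y2⟩ := fderiv_transversal_lift hU hΦ hinj hM hz hα hα' (htr _ _ _ h2)
  have hs : ∀ b : ℝ, fderiv ℝ Φ z ((0, 1, 0), b) =
      fderiv ℝ Φ z ((0, 1, 0), 0) + b • fderiv ℝ Φ z (0, 1) := by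
    intro b
    rw [← map_smul, ← map_add]
    congr 1
    ext <;> simp
  rw [hs] at t1 t2 y1 y2
  simp only [Prod.fst_add, Prod.snd_add, Prod.smul_fst, Prod.smul_snd, smul_eq_mul]
    at t1 t2 y1 y2
  have hb' := sub_ne_zero.2 hb
  have ht : (fderiv ℝ Φ z (0, 1)).1.1 = 0 := by
    apply mul_left_cancel₀ hb'
    linarith
  have hy : (fderiv ℝ Φ z (0, 1)).1.2.2 = 0 := by
    apply mul_left_cancel₀ hb'
    linarith
  rw [ht] at t1
  rw [hy] at y1
  exact ⟨⟨by linarith, by linarith⟩, ht, hy⟩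

end Jets

/-- The coordinate vector field `∂/∂t`. -/
abbrev eT : Vars := ((1, 0, 0), 0)

/-- The coordinate vector field `∂/∂x`. -/
abbrev eX : Vars := ((0, 1, 0), 0)

/-- The coordinate vector field `∂/∂y`. -/
abbrev eY : Vars := ((0, 0, 1), 0)

/-- The coordinate vector field `∂/∂u`. -/
abbrev eU : Vars := (0, 1)

theorem clm_apply_eq {F : Type*} [NormedAddCommGroup F] [NormedSpace ℝ F] (L : Vars →L[ℝ] F)
    (w : Vars) :
    L w = w.1.1 • L eT + w.1.2.1 • L eX + w.1.2.2 • L eY + w.2 • L eU := by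
  simp only [← map_smul, ← map_add]
  congr 1
  ext <;> simp

theorem base_clm_apply_eq (l : Base →L[ℝ] ℝ) (w : Base) :
    l w = w.1 * l (1, 0, 0) + w.2.1 * l (0, 1, 0) + w.2.2 * l (0, 0, 1) := by
  simp only [← smul_eq_mul, ← map_smul, ← map_add]
  congr 1
  ext <;> simp

/-- The Jacobian of the `(t, y)`-components. -/
noncomputable def tyJacobian (L : Vars →L[ℝ] Vars) : ℝ :=
  (L eT).1.1 * (L eY).1.2.2 - (L eY).1.1 * (L eT).1.2.2

section Algebra

variable {L : Vars →L[ℝ] Vars}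

theorem tyJacobian_ne_zero (hinj : Function.Injective L)
    (hTx : (L eX).1.1 = 0) (hYx : (L eX).1.2.2 = 0) (hTu : (L eU).1.1 = 0)
    (hYu : (L eU).1.2.2 = 0) : tyJacobian L ≠ 0 := by
  intro h
  unfold tyJacobian at h
  have hsurj : Function.Surjective L :=
    (LinearMap.injective_iff_surjective (f := (L : Vars →ₗ[ℝ] Vars))).1 hinj
  obtain ⟨v, hv⟩ := hsurj ((1, 0, 0), 0)
  obtain ⟨w, hw⟩ := hsurj ((0, 0, 1), 0)
  rw [clm_apply_eq] at hv hw
  have v1 := congrArg (fun w : Vars => w.1.1) hv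
  have v2 := congrArg (fun w : Vars => w.1.2.2) hv
  have w1 := congrArg (fun w : Vars => w.1.1) hw
  have w2 := congrArg (fun w : Vars => w.1.2.2) hw
  simp only [Prod.fst_add, Prod.snd_add, Prod.smul_fst, Prod.smul_snd, smul_eq_mul, hTx, hYx, hTu,
    hYu] at v1 v2 w1 w2
  have : (v.1.1 * (L eT).1.1 + v.1.2.2 * (L eY).1.1) *
      (w.1.1 * (L eT).1.2.2 + w.1.2.2 * (L eY).1.2.2) -
      (v.1.1 * (L eT).1.2.2 + v.1.2.2 * (L eY).1.2.2) *
      (w.1.1 * (L eT).1.1 + w.1.2.2 * (L eY).1.1) = 0 := by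
    linear_combination (v.1.1 * w.1.2.2 - v.1.2.2 * w.1.1) * h
  have e1 : v.1.1 * (L eT).1.1 + v.1.2.2 * (L eY).1.1 = 1 := by linarith
  have e2 : w.1.1 * (L eT).1.2.2 + w.1.2.2 * (L eY).1.2.2 = 1 := by linarith
  have e3 : v.1.1 * (L eT).1.2.2 + v.1.2.2 * (L eY).1.2.2 = 0 := by linarith
  rw [e1, e2, e3] at this
  norm_num at this

theorem transversal_of_ne_zero (hinj : Function.Injective L)
    (hTx : (L eX).1.1 = 0) (hYx : (L eX).1.2.2 = 0) (hTu : (L eU).1.1 = 0)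
    (hYu : (L eU).1.2.2 = 0) {a b c : ℝ} (hb : (L eX).1.2.1 + b * (L eU).1.2.1 ≠ 0) (e : Base)
    (he : (L (e, covector a b c e)).1 = 0) : e = 0 := by
  have hδ := tyJacobian_ne_zero hinj hTx hYx hTu hYu
  unfold tyJacobian at hδ
  rw [clm_apply_eq] at he
  have h1 := congrArg (fun w : Base => w.1) he
  have h2 := congrArg (fun w : Base => w.2.1) he
  have h3 := congrArg (fun w : Base => w.2.2) he
  simp only [Prod.fst_add, Prod.snd_add, Prod.smul_fst, Prod.smul_snd, smul_eq_mul, hTx, hYx, hTu,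
    hYu, covector_apply, Prod.fst_zero, Prod.snd_zero] at h1 h2 h3
  have e1 : e.1 = 0 := by
    apply mul_left_cancel₀ hδ
    linear_combination (L eY).1.2.2 * h1 - (L eY).1.1 * h3
  have e3 : e.2.2 = 0 := by
    apply mul_left_cancel₀ hδ
    linear_combination (L eT).1.1 * h3 - (L eT).1.2.2 * h1
  have e2 : e.2.1 = 0 := by
    apply mul_left_cancel₀ hb
    rw [e1, e3] at h2
    linear_combination h2
  ext <;> simp [e1, e2, e3]

theorem symbol_relation (hinj : Function.Injective L)
    (hTx : (L eX).1.1 = 0) (hYx : (L eX).1.2.2 = 0) (hTu : (L eU).1.1 = 0)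
    (hYu : (L eU).1.2.2 = 0) {a b c K X S₀ S₁ : ℝ}
    (hb : (L eX).1.2.1 + b * (L eU).1.2.1 ≠ 0)
    {M : Vars} (hMt : M.1.1 = 0) (hMy : M.1.2.2 = 0) {l₀ l₁ : Base →L[ℝ] ℝ}
    {Q₀ Q₁ : Base →L[ℝ] Base →L[ℝ] ℝ}
    (i₀ : ∀ e, l₀ (L (e, covector 0 b 0 e)).1 = (L (e, covector 0 b 0 e)).2)
    (i₁ : ∀ e, l₁ (L (e, covector a b c e)).1 = (L (e, covector a b c e)).2)
    (ii₀ : Q₀ (L ((0, 1, 0), b)).1 (L ((0, 1, 0), b)).1 + l₀ (M + L (0, S₀)).1 =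
      (M + L (0, S₀)).2)
    (ii₁ : Q₁ (L ((0, 1, 0), b)).1 (L ((0, 1, 0), b)).1 + l₁ (M + L (0, S₁)).1 =
      (M + L (0, S₁)).2)
    (iii₀ : l₀ (1, 0, 0) + X * l₀ (0, 0, 1) = K * Q₀ (0, 1, 0) (0, 1, 0))
    (iii₁ : l₁ (1, 0, 0) + X * l₁ (0, 0, 1) = K * Q₁ (0, 1, 0) (0, 1, 0)) :
    (a * ((L eY).1.2.2 - X * (L eY).1.1) + c * (X * (L eT).1.1 - (L eT).1.2.2)) *
      ((L eX).1.2.1 + b * (L eU).1.2.1) ^ 2 = tyJacobian L * K * (S₁ - S₀) := by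
  unfold tyJacobian
  set κ := (L eX).1.2.1 + b * (L eU).1.2.1 with hκ
  have hJx : (L ((0, 1, 0), b)).1 = κ • (0, 1, 0) := by
    rw [clm_apply_eq]
    ext <;> simp [hTx, hYx, hTu, hYu, hκ]
  have t0 := i₀ (1, 0, 0)
  have x0 := i₀ (0, 1, 0)
  have y0 := i₀ (0, 0, 1)
  have t1 := i₁ (1, 0, 0)
  have x1 := i₁ (0, 1, 0)
  have y1 := i₁ (0, 0, 1)
  rw [hJx, base_clm_apply_eq l₀ (M + L (0, S₀)).1, clm_apply_eq L (0, S₀)] at ii₀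
  rw [hJx, base_clm_apply_eq l₁ (M + L (0, S₁)).1, clm_apply_eq L (0, S₁)] at ii₁
  rw [clm_apply_eq, base_clm_apply_eq] at t0 x0 y0 t1 x1 y1
  simp only [Prod.fst_add, Prod.snd_add, Prod.smul_fst, Prod.smul_snd, smul_eq_mul, hTx, hYx, hTu,
    hYu, covector_apply, Prod.fst_zero, Prod.snd_zero, hMt, hMy, map_smul, mul_zero, mul_one,
    add_zero, zero_add, zero_mul, one_mul, smul_apply]
    at t0 x0 y0 t1 x1 y1 ii₀ ii₁
  have hlx : l₁ (0, 1, 0) = l₀ (0, 1, 0) := by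
    apply mul_left_cancel₀ hb
    linear_combination x1 - x0
  rw [hlx] at t1 x1 y1 ii₁
  have hw : (L eU).2 - l₀ (0, 1, 0) * (L eU).1.2.1 ≠ 0 := by
    intro h
    have h1 : L (κ • eU - (L eU).1.2.1 • ((0, 1, 0), b)) = 0 := by
      rw [map_sub, map_smul, map_smul, clm_apply_eq L ((0, 1, 0), b)]
      ext
      · simp [hTx, hTu]
      · simp [hκ]; ring
      · simp [hYx, hYu]
      · simp
        linear_combination κ * h + (L eU).1.2.1 * x0
    have h2 : κ • eU - (L eU).1.2.1 • (((0, 1, 0), b) : Vars) = 0 := hinj (h1.trans (map_zero L).symm)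
    have h3 := congrArg (fun w : Vars => w.1.2.1) h2
    have h4 := congrArg (fun w : Vars => w.2) h2
    simp at h3 h4
    rw [h3] at h4
    simp at h4
    exact hb h4
  apply mul_left_cancel₀ hw
  set w := (L eU).2 - l₀ (0, 1, 0) * (L eU).1.2.1 with hwdef
  have dt : (l₁ (1, 0, 0) - l₀ (1, 0, 0)) * (L eT).1.1 +
      (l₁ (0, 0, 1) - l₀ (0, 0, 1)) * (L eT).1.2.2 = a * w := by
    linear_combination t1 - t0
  have dy : (l₁ (1, 0, 0) - l₀ (1, 0, 0)) * (L eY).1.1 +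
      (l₁ (0, 0, 1) - l₀ (0, 0, 1)) * (L eY).1.2.2 = c * w := by
    linear_combination y1 - y0
  have dq : (Q₁ (0, 1, 0) (0, 1, 0) - Q₀ (0, 1, 0) (0, 1, 0)) * κ ^ 2 = (S₁ - S₀) * w := by
    linear_combination ii₁ - ii₀
  linear_combination -κ ^ 2 * ((L eY).1.2.2 - X * (L eY).1.1) * dt -
    κ ^ 2 * (X * (L eT).1.1 - (L eT).1.2.2) * dy +
    ((L eT).1.1 * (L eY).1.2.2 - (L eY).1.1 * (L eT).1.2.2) * K * dq +
    κ ^ 2 * ((L eT).1.1 * (L eY).1.2.2 - (L eY).1.1 * (L eT).1.2.2) * (iii₁ - iii₀)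

end Algebra

section Symbols

variable {U : Set Vars} {Φ : Vars → Vars} {z : Vars}

theorem fderiv_fderiv_component {F : Vars →L[ℝ] ℝ} {v : Vars} {k : ℝ} (hU : IsOpen U)
    (hΦ : ContDiffOn ℝ ∞ Φ U) (h : ∀ z ∈ U, F (fderiv ℝ Φ z v) = k) (hz : z ∈ U) (w : Vars) :
    F (fderiv ℝ (fderiv ℝ Φ) z w v) = 0 := by
  have hd : DifferentiableAt ℝ (fderiv ℝ Φ) z :=
    ((hΦ.contDiffAt (hU.mem_nhds hz)).fderiv_right (m := 1)
      (by norm_cast)).differentiableAt (by simp)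
  have h1 := F.hasFDerivAt.comp z (hd.hasFDerivAt.clm_apply (hasFDerivAt_const v z))
  have h2 : HasFDerivAt (F ∘ fun z => fderiv ℝ Φ z v) (0 : Vars →L[ℝ] ℝ) z :=
    (hasFDerivAt_const k z).congr_of_eventuallyEq
      (eventually_of_mem (hU.mem_nhds hz) fun q hq => h q hq)
  have h3 := congrArg (fun l : Vars →L[ℝ] ℝ => l w) (h1.unique h2)
  simpa using h3

/-- The projection to the component `t`. -/
noncomputable abbrev projT : Vars →L[ℝ] ℝ :=
  (ContinuousLinearMap.fst ℝ ℝ (ℝ × ℝ)).comp (ContinuousLinearMap.fst ℝ Base ℝ)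

/-- The projection to the component `y`. -/
noncomputable abbrev projY : Vars →L[ℝ] ℝ :=
  (ContinuousLinearMap.snd ℝ ℝ ℝ).comp
    ((ContinuousLinearMap.snd ℝ ℝ (ℝ × ℝ)).comp (ContinuousLinearMap.fst ℝ Base ℝ))

/-- The projection to the component `x`. -/
noncomputable abbrev projX : Vars →L[ℝ] ℝ :=
  (ContinuousLinearMap.fst ℝ ℝ ℝ).comp
    ((ContinuousLinearMap.snd ℝ ℝ (ℝ × ℝ)).comp (ContinuousLinearMap.fst ℝ Base ℝ))

/-- The components `t` and `y` of `Φ` depend only on `t` and `y`, infinitesimally. -/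
def IsTYProjectable (U : Set Vars) (Φ : Vars → Vars) : Prop :=
  ∀ z ∈ U, ((fderiv ℝ Φ z eX).1.1 = 0 ∧ (fderiv ℝ Φ z eX).1.2.2 = 0) ∧
    ((fderiv ℝ Φ z eU).1.1 = 0 ∧ (fderiv ℝ Φ z eU).1.2.2 = 0)

theorem IsTYProjectable.fderiv_fderiv (h : IsTYProjectable U Φ) (hU : IsOpen U)
    (hΦ : ContDiffOn ℝ ∞ Φ U) (hz : z ∈ U) (w : Vars) (b : ℝ) :
    (fderiv ℝ (fderiv ℝ Φ) z w ((0, 1, 0), b)).1.1 = 0 ∧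
    (fderiv ℝ (fderiv ℝ Φ) z w ((0, 1, 0), b)).1.2.2 = 0 := by
  constructor
  · refine fderiv_fderiv_component (F := projT) (k := 0) hU hΦ (fun z hz => ?_) hz w
    rw [clm_apply_eq (fderiv ℝ Φ z)]
    simp [(h z hz).1.1, (h z hz).2.1]
  · refine fderiv_fderiv_component (F := projY) (k := 0) hU hΦ (fun z hz => ?_) hz w
    rw [clm_apply_eq (fderiv ℝ Φ z)]
    simp [(h z hz).1.2, (h z hz).2.2]

theorem symbol_relation_zero (hU : IsOpen U) (hΦ : ContDiffOn ℝ ∞ Φ U)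
    (hP : IsTYProjectable U Φ)
    (hinj : Function.Injective (fderiv ℝ Φ z)) {α : ℝ}
    {θ' : Params} (hM : MapsEquation U Φ (α, 0) θ') (hz : z ∈ U) (hα : z.1.2.1 ≠ α)
    (hα' : (Φ z).1.2.1 ≠ θ'.1) (a c : ℝ) {b : ℝ}
    (hb : (fderiv ℝ Φ z eX).1.2.1 + b * (fderiv ℝ Φ z eU).1.2.1 ≠ 0) :
    (a * ((fderiv ℝ Φ z eY).1.2.2 - (Φ z).1.2.1 * (fderiv ℝ Φ z eY).1.1) +
      c * ((Φ z).1.2.1 * (fderiv ℝ Φ z eT).1.1 - (fderiv ℝ Φ z eT).1.2.2)) *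
      ((fderiv ℝ Φ z eX).1.2.1 + b * (fderiv ℝ Φ z eU).1.2.1) ^ 2 =
    tyJacobian (fderiv ℝ Φ z) * |(Φ z).1.2.1 - θ'.1| ^ θ'.2 * (a + c * z.1.2.1) := by
  obtain ⟨⟨h1, h2⟩, h3, h4⟩ := hP z hz
  obtain ⟨l₀, Q₀, i₀, ii₀, iii₀⟩ := exists_transformed_jet_zero hU hΦ hM hz hα hα' 0 b 0 0 0
    (transversal_of_ne_zero hinj h1 h2 h3 h4 hb)
  obtain ⟨l₁, Q₁, i₁, ii₁, iii₁⟩ := exists_transformed_jet_zero hU hΦ hM hz hα hα' a b c 0 0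
    (transversal_of_ne_zero hinj h1 h2 h3 h4 hb)
  have j₀ := ii₀ (0, 1, 0)
  have j₁ := ii₁ (0, 1, 0)
  simp only [covector_apply, mul_zero, mul_one, zero_mul, zero_add, add_zero, one_pow,
    ne_eq, OfNat.ofNat_ne_zero, not_false_eq_true, zero_pow] at j₀ j₁
  obtain ⟨m1, m2⟩ := hP.fderiv_fderiv hU hΦ hz ((0, 1, 0), b) b
  have := symbol_relation hinj h1 h2 h3 h4 hb m1 m2 i₀ i₁ j₀ j₁ iii₀ iii₁
  simpa using this

theorem symbol_relation_general (hU : IsOpen U) (hΦ : ContDiffOn ℝ ∞ Φ U)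
    (hP : IsTYProjectable U Φ)
    (hinj : Function.Injective (fderiv ℝ Φ z)) {θ θ' : Params} (hM : MapsEquation U Φ θ θ')
    (hθ₁ : θ.2 ≠ 1) (hθ₂ : θ.2 ≠ 2) (hz : z ∈ U) (hα : z.1.2.1 ≠ θ.1)
    (hα' : (Φ z).1.2.1 ≠ θ'.1) {b : ℝ}
    (hb : (fderiv ℝ Φ z eX).1.2.1 + b * (fderiv ℝ Φ z eU).1.2.1 ≠ 0) :
    ((fderiv ℝ Φ z eY).1.2.2 - (Φ z).1.2.1 * (fderiv ℝ Φ z eY).1.1) *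
      ((fderiv ℝ Φ z eX).1.2.1 + b * (fderiv ℝ Φ z eU).1.2.1) ^ 2 * |z.1.2.1 - θ.1| ^ θ.2 =
    tyJacobian (fderiv ℝ Φ z) * |(Φ z).1.2.1 - θ'.1| ^ θ'.2 := by
  obtain ⟨⟨h1, h2⟩, h3, h4⟩ := hP z hz
  obtain ⟨l₀, Q₀, S₀, s₀, i₀, ii₀, iii₀⟩ := exists_transformed_jet_general hU hΦ hM hθ₁ hθ₂ hz hα
    hα' 0 b (transversal_of_ne_zero hinj h1 h2 h3 h4 hb)
  obtain ⟨l₁, Q₁, S₁, s₁, i₁, ii₁, iii₁⟩ := exists_transformed_jet_general hU hΦ hM hθ₁ hθ₂ hz hα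
    hα' 1 b (transversal_of_ne_zero hinj h1 h2 h3 h4 hb)
  obtain ⟨m1, m2⟩ := hP.fderiv_fderiv hU hΦ hz ((0, 1, 0), b) b
  have := symbol_relation hinj h1 h2 h3 h4 hb m1 m2 i₀ i₁ ii₀ ii₁ iii₀ iii₁
  linear_combination |z.1.2.1 - θ.1| ^ θ.2 * this +
    tyJacobian (fderiv ℝ Φ z) * |(Φ z).1.2.1 - θ'.1| ^ θ'.2 * (s₁ - s₀)

end Symbols

theorem eq_abs_rpow_of_power_law {h F : ℝ → ℝ} {k F₀ b β : ℝ} (hh : HasDerivAt h k 0)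
    (h0 : h 0 = 0) (hk : k ≠ 0) (hF : Tendsto F (𝓝[≠] 0) (𝓝 F₀)) (hF₀ : 0 < F₀)
    (hb : ∀ᶠ s in 𝓝[≠] (0 : ℝ), F s * |s| ^ b = |h s| ^ β) : F₀ = |k| ^ b := by
  have hq : Tendsto (fun s => |h s| / |s|) (𝓝[≠] 0) (𝓝 |k|) := by
    have := (hasDerivAt_iff_tendsto_slope.1 hh).abs
    refine this.congr fun s => ?_
    simp [slope_def_field, h0, abs_div]
  have hk0 : 0 < |k| := abs_pos.2 hk
  have hqβ : Tendsto (fun s => (|h s| / |s|) ^ β) (𝓝[≠] 0) (𝓝 (|k| ^ β)) :=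
    hq.rpow_const (Or.inl hk0.ne')
  have hkβ : 0 < |k| ^ β := Real.rpow_pos_of_pos hk0 _
  have hlim : Tendsto (fun s => |s| ^ (b - β)) (𝓝[≠] 0) (𝓝 (|k| ^ β / F₀)) := by
    refine (hqβ.div hF hF₀.ne').congr' ?_
    filter_upwards [hb, self_mem_nhdsWithin, hF.eventually_ne hF₀.ne'] with s hs hs0 hFs
    have hs1 : 0 < |s| := abs_pos.2 hs0
    change (|h s| / |s|) ^ β / F s = _
    rw [Real.div_rpow (abs_nonneg _) hs1.le, ← hs, Real.rpow_sub hs1]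
    have := (Real.rpow_pos_of_pos hs1 β).ne'
    field_simp
  have habs : Tendsto (fun s : ℝ => |s|) (𝓝[≠] 0) (𝓝 0) := by
    have : Tendsto (fun s : ℝ => |s|) (𝓝 0) (𝓝 |0|) := continuous_abs.tendsto 0
    rw [abs_zero] at this
    exact this.mono_left nhdsWithin_le_nhds
  have hpow : ∀ γ : ℝ, 0 < γ → Tendsto (fun s : ℝ => |s| ^ γ) (𝓝[≠] 0) (𝓝 0) := fun γ hγ => by
    simpa [Real.zero_rpow hγ.ne'] using habs.rpow_const (p := γ) (Or.inr hγ.le)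
  have hpos : 0 < |k| ^ β / F₀ := div_pos hkβ hF₀
  have hγ : b - β = 0 := by
    rcases lt_trichotomy (b - β) 0 with h1 | h1 | h1
    · exfalso
      have h2 := hlim.inv₀ hpos.ne'
      have h3 : Tendsto (fun s : ℝ => (|s| ^ (b - β))⁻¹) (𝓝[≠] 0) (𝓝 0) := by
        refine (hpow (-(b - β)) (by linarith)).congr fun s => ?_
        rw [Real.rpow_neg (abs_nonneg s)]
      exact (inv_pos.2 hpos).ne (tendsto_nhds_unique h3 h2)
    · exact h1
    · exact absurd (tendsto_nhds_unique (hpow _ h1) hlim) hpos.ne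
  rw [hγ] at hlim
  have h1 : (1 : ℝ) = |k| ^ β / F₀ :=
    tendsto_nhds_unique (tendsto_const_nhds.congr fun s => (Real.rpow_zero _).symm) hlim
  have hbβ : b = β := by linarith
  rw [hbβ]
  field_simp at h1
  exact h1

theorem eq_on_slice_of_power_law {X F : Vars → ℝ} {z : Vars} {α' b β : ℝ} (hb : b < 0)
    (hX : ∀ᶠ w in 𝓝 z, ContinuousAt X w) (hF : ∀ᶠ w in 𝓝 z, ContinuousAt F w) (hF0 : 0 < F z)
    (h : ∀ᶠ w in 𝓝 z, w.1.2.1 ≠ z.1.2.1 → X w ≠ α' →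
      F w * |w.1.2.1 - z.1.2.1| ^ b = |X w - α'| ^ β) :
    ∀ᶠ w in 𝓝 z, w.1.2.1 = z.1.2.1 → X w = α' := by
  filter_upwards [hX, hF, hF.self_of_nhds.eventually (lt_mem_nhds hF0), h.eventually_nhds] with
    w hXw hFw hF0w hw hwx
  by_contra hne
  have hc : Tendsto (fun s : ℝ => w + s • eX) (𝓝[≠] 0) (𝓝 w) := by
    have : Continuous fun s : ℝ => w + s • eX := by fun_prop
    have h1 := (this.tendsto 0).mono_left (nhdsWithin_le_nhds (s := {0}ᶜ))
    simpa using h1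
  have h1 : Tendsto (fun s : ℝ => F (w + s • eX)) (𝓝[≠] 0) (𝓝 (F w)) := hFw.tendsto.comp hc
  have h2 : Tendsto (fun s : ℝ => |X (w + s • eX) - α'| ^ β * |s| ^ (-b)) (𝓝[≠] 0)
      (𝓝 (|X w - α'| ^ β * 0)) := by
    refine Tendsto.mul ?_ ?_
    · exact ((((hXw.tendsto.comp hc).sub_const α').abs).rpow_const
        (Or.inl (abs_pos.2 (sub_ne_zero.2 hne)).ne'))
    · have : Tendsto (fun s : ℝ => |s|) (𝓝[≠] 0) (𝓝 0) := by
        have : Tendsto (fun s : ℝ => |s|) (𝓝 0) (𝓝 |0|) := continuous_abs.tendsto 0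
        rw [abs_zero] at this
        exact this.mono_left nhdsWithin_le_nhds
      have h3 := this.rpow_const (p := -b) (Or.inr (by linarith))
      rwa [Real.zero_rpow (by linarith)] at h3
  have h3 : (fun s : ℝ => F (w + s • eX)) =ᶠ[𝓝[≠] 0]
      fun s => |X (w + s • eX) - α'| ^ β * |s| ^ (-b) := by
    filter_upwards [hc.eventually hw, (hXw.tendsto.comp hc).eventually_ne hne,
      self_mem_nhdsWithin] with s hs hXs hs0
    have hx : (w + s • eX).1.2.1 - z.1.2.1 = s := by simp [hwx]
    have hx' : (w + s • eX).1.2.1 ≠ z.1.2.1 := by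
      rw [← sub_ne_zero, hx]; exact hs0
    have h4 := hs hx' hXs
    rw [hx] at h4
    rw [← h4, Real.rpow_neg (abs_nonneg s)]
    have := (Real.rpow_pos_of_pos (abs_pos.2 hs0) b).ne'
    field_simp
  have h4 := tendsto_nhds_unique (h1.congr' h3) h2
  rw [mul_zero] at h4
  exact hF0w.ne' h4

theorem rigidity_of_power_laws {X F : Vars → ℝ} {z : Vars} {d : Vars →L[ℝ] ℝ}
    (hd : HasFDerivAt X d z) (hdx : d eX ≠ 0)
    (hX : ∀ᶠ w in 𝓝 z, ContinuousAt X w) (hF : ∀ᶠ w in 𝓝 z, ContinuousAt F w) (hF0 : 0 < F z)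
    {θ₁ θ₂ : Params}
    (h₁ : ∀ᶠ w in 𝓝 z, w.1.2.1 ≠ z.1.2.1 → X w ≠ θ₁.1 →
      F w * |w.1.2.1 - z.1.2.1| ^ (-2 : ℝ) = |X w - θ₁.1| ^ θ₁.2)
    (h₂ : ∀ᶠ w in 𝓝 z, w.1.2.1 ≠ z.1.2.1 → X w ≠ θ₂.1 →
      F w * |w.1.2.1 - z.1.2.1| ^ (-4 : ℝ) = |X w - θ₂.1| ^ θ₂.2) :
    d eT = 0 ∧ d eY = 0 ∧ d eX ^ 2 = 1 ∧ F z = 1 := by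
  have s₁ := eq_on_slice_of_power_law (by norm_num) hX hF hF0 h₁
  have s₂ := eq_on_slice_of_power_law (by norm_num) hX hF hF0 h₂
  have hz₁ : X z = θ₁.1 := s₁.self_of_nhds rfl
  have hz₂ : X z = θ₂.1 := s₂.self_of_nhds rfl
  have hline : ∀ v : Vars, HasDerivAt (fun s : ℝ => z + s • v) v 0 := fun v => by
    simpa using ((hasDerivAt_id (0 : ℝ)).smul_const v).const_add z
  have hXl : ∀ v : Vars, HasDerivAt (fun s : ℝ => X (z + s • v)) (d v) 0 := fun v => by
    have hd' : HasFDerivAt X d (z + (0 : ℝ) • v) := by simpa using hd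
    exact hd'.comp_hasDerivAt (0 : ℝ) (hline v)
  have hl : ∀ v : Vars, Tendsto (fun s : ℝ => z + s • v) (𝓝 0) (𝓝 z) := fun v => by
    simpa using (hline v).continuousAt.tendsto
  have hzero : ∀ v : Vars, v.1.2.1 = 0 → d v = 0 := by
    intro v hv
    refine (hXl v).unique ((hasDerivAt_const (0 : ℝ) θ₁.1).congr_of_eventuallyEq ?_)
    filter_upwards [(hl v).eventually s₁] with s hs
    exact hs (by simp [hv])
  have hne : ∀ᶠ s in 𝓝[≠] (0 : ℝ), X (z + s • eX) ≠ X z := by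
    simpa using (hXl eX).eventually_ne (c := X z) hdx
  have hFl : Tendsto (fun s : ℝ => F (z + s • eX)) (𝓝[≠] 0) (𝓝 (F z)) :=
    hF.self_of_nhds.tendsto.comp ((hl eX).mono_left nhdsWithin_le_nhds)
  have key : ∀ (θ : Params) (b : ℝ), X z = θ.1 →
      (∀ᶠ w in 𝓝 z, w.1.2.1 ≠ z.1.2.1 → X w ≠ θ.1 →
        F w * |w.1.2.1 - z.1.2.1| ^ b = |X w - θ.1| ^ θ.2) → F z = |d eX| ^ b := by
    intro θ b hθ hb
    refine eq_abs_rpow_of_power_law (h := fun s => X (z + s • eX) - X z) (β := θ.2)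
      ((hXl eX).sub_const _) (by simp) hdx hFl hF0 ?_
    filter_upwards [((hl eX).mono_left (nhdsWithin_le_nhds (s := {0}ᶜ))).eventually hb, hne,
      self_mem_nhdsWithin] with s hs hs1 hs0
    have hx : (z + s • eX).1.2.1 - z.1.2.1 = s := by simp
    have h4 := hs (by rw [← sub_ne_zero, hx]; exact hs0) (hθ ▸ hs1)
    rwa [hx, ← hθ] at h4
  have k₁ := key θ₁ _ hz₁ h₁
  have k₂ := key θ₂ _ hz₂ h₂
  have hk : 0 < |d eX| := abs_pos.2 hdx
  rw [Real.rpow_neg hk.le] at k₁ k₂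
  have p2 : |d eX| ^ (2 : ℝ) = |d eX| ^ 2 := Real.rpow_two _
  have p4 : |d eX| ^ (4 : ℝ) = |d eX| ^ 4 := by exact_mod_cast Real.rpow_natCast _ 4
  rw [p2] at k₁
  rw [p4] at k₂
  have hsq : |d eX| ^ 2 = 1 := by
    rw [k₁] at k₂
    field_simp at k₂
    exact k₂
  refine ⟨hzero _ rfl, hzero _ rfl, by rwa [sq_abs] at hsq, ?_⟩
  rw [k₁, hsq, inv_one]

theorem subset_closure_regular {U : Set Vars} (hU : IsOpen U) {X : Vars → ℝ}
    (hX : ∀ z ∈ U, fderiv ℝ X z ≠ 0) (α α' : ℝ) :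
    U ⊆ closure {z | z ∈ U ∧ z.1.2.1 ≠ α ∧ X z ≠ α'} := by
  intro z hz
  rw [mem_closure_iff_frequently]
  intro hcon
  have hc : Tendsto (fun s : ℝ => z + s • eX) (𝓝[≠] 0) (𝓝 z) := by
    have : Continuous fun s : ℝ => z + s • eX := by fun_prop
    have h1 := (this.tendsto 0).mono_left (nhdsWithin_le_nhds (s := {0}ᶜ))
    simpa using h1
  have hx : ∀ᶠ s : ℝ in 𝓝[≠] 0, (z + s • eX).1.2.1 ≠ α := by
    have h1 : HasDerivAt (fun s : ℝ => (z + s • eX).1.2.1) 1 0 := by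
      simpa using (hasDerivAt_id (0 : ℝ)).const_add z.1.2.1
    exact h1.eventually_ne one_ne_zero
  obtain ⟨s, hs, hsx, hsU⟩ := ((hc.eventually hcon.eventually_nhds).and
    (hx.and (hc.eventually (hU.mem_nhds hz)))).exists
  refine hX _ hsU ?_
  have hev : X =ᶠ[𝓝 (z + s • eX)] fun _ => α' := by
    have hop : IsOpen {w : Vars | w.1.2.1 ≠ α} := isOpen_ne_fun (by fun_prop) continuous_const
    filter_upwards [hs, hU.mem_nhds hsU, hop.mem_nhds hsx] with w hw hwU hwx
    by_contra hne
    exact hw ⟨hwU, hwx, hne⟩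
  rw [hev.fderiv_eq]
  simp

/-- The derivative of `f` in the direction of the constant vector field `v`. -/
noncomputable def pd (v : Vars) (f : Vars → ℝ) (z : Vars) : ℝ := fderiv ℝ f z v

section PartialDerivatives

variable {U : Set Vars} {f g : Vars → ℝ}

theorem differentiableAt_of_contDiffOn (hU : IsOpen U) (hf : ContDiffOn ℝ ∞ f U) {z : Vars}
    (hz : z ∈ U) : DifferentiableAt ℝ f z :=
  (hf.contDiffAt (hU.mem_nhds hz)).differentiableAt (by simp)

theorem contDiffOn_pd (hU : IsOpen U) (hf : ContDiffOn ℝ ∞ f U) (v : Vars) :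
    ContDiffOn ℝ ∞ (pd v f) U :=
  (hf.fderiv_of_isOpen hU (by norm_cast)).clm_apply contDiffOn_const

theorem pd_congr (hU : IsOpen U) (h : EqOn f g U) (v : Vars) : EqOn (pd v f) (pd v g) U := by
  intro z hz
  unfold pd
  rw [(h.eventuallyEq_of_mem (hU.mem_nhds hz)).fderiv_eq]

theorem pd_eq_zero_of_eqOn_const (hU : IsOpen U) {c : ℝ} (h : ∀ z ∈ U, f z = c) (v : Vars) :
    ∀ z ∈ U, pd v f z = 0 := by
  intro z hz
  rw [pd_congr hU (g := fun _ => c) h v hz]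
  simp [pd]

theorem pd_comm (hU : IsOpen U) (hf : ContDiffOn ℝ ∞ f U) (v w : Vars) :
    EqOn (pd v (pd w f)) (pd w (pd v f)) U := by
  intro z hz
  have hfz := hf.contDiffAt (hU.mem_nhds hz)
  have hd : DifferentiableAt ℝ (fderiv ℝ f) z :=
    (hfz.fderiv_right (m := 1) (by norm_cast)).differentiableAt (by simp)
  have h : ∀ v w, pd v (pd w f) z = fderiv ℝ (fderiv ℝ f) z v w := fun v w => by
    unfold pd
    rw [(hd.hasFDerivAt.clm_apply (hasFDerivAt_const w z)).fderiv]
    simp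
  rw [h, h]
  exact hfz.isSymmSndFDerivAt (by simp; norm_cast) v w

theorem pd_mul (hU : IsOpen U) (hf : ContDiffOn ℝ ∞ f U) (hg : ContDiffOn ℝ ∞ g U) (v : Vars)
    {z : Vars} (hz : z ∈ U) :
    pd v (fun z => f z * g z) z = f z * pd v g z + pd v f z * g z := by
  unfold pd
  rw [((differentiableAt_of_contDiffOn hU hf hz).hasFDerivAt.fun_mul
    (differentiableAt_of_contDiffOn hU hg hz).hasFDerivAt).fderiv]
  simp [mul_comm (g z)]

theorem pd_sub (hU : IsOpen U) (hf : ContDiffOn ℝ ∞ f U) (hg : ContDiffOn ℝ ∞ g U) (v : Vars)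
    {z : Vars} (hz : z ∈ U) :
    pd v (fun z => f z - g z) z = pd v f z - pd v g z := by
  unfold pd
  rw [((differentiableAt_of_contDiffOn hU hf hz).hasFDerivAt.fun_sub
    (differentiableAt_of_contDiffOn hU hg hz).hasFDerivAt).fderiv]
  simp

theorem pd_add (hU : IsOpen U) (hf : ContDiffOn ℝ ∞ f U) (hg : ContDiffOn ℝ ∞ g U) (v : Vars)
    {z : Vars} (hz : z ∈ U) :
    pd v (fun z => f z + g z) z = pd v f z + pd v g z := by
  unfold pd
  rw [((differentiableAt_of_contDiffOn hU hf hz).hasFDerivAt.fun_add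
    (differentiableAt_of_contDiffOn hU hg hz).hasFDerivAt).fderiv]
  simp

theorem pd_x (v z : Vars) : pd v (fun z => z.1.2.1) z = v.1.2.1 := by
  have h : HasFDerivAt (fun z : Vars => z) (ContinuousLinearMap.id ℝ Vars) z := hasFDerivAt_id z
  unfold pd
  rw [h.fst.snd.fst.fderiv]
  simp

/-- A function with vanishing partial derivatives on a connected open set is constant there. -/
theorem exists_eq_const_of_pd (hU : IsOpen U) (hUc : IsConnected U) (hf : ContDiffOn ℝ ∞ f U)
    (ht : ∀ z ∈ U, pd eT f z = 0) (hx : ∀ z ∈ U, pd eX f z = 0) (hy : ∀ z ∈ U, pd eY f z = 0)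
    (hu : ∀ z ∈ U, pd eU f z = 0) : ∃ c, ∀ z ∈ U, f z = c := by
  refine hU.exists_is_const_of_fderiv_eq_zero (𝕜 := ℝ) hUc.isPreconnected
    (fun z hz => (differentiableAt_of_contDiffOn hU hf hz).differentiableWithinAt) ?_
  intro z hz
  refine ContinuousLinearMap.ext fun v => ?_
  rw [clm_apply_eq]
  have h1 := ht z hz
  have h2 := hx z hz
  have h3 := hy z hz
  have h4 := hu z hz
  simp only [pd] at h1 h2 h3 h4
  simp [h1, h2, h3, h4]

end PartialDerivatives

section Extension

variable {U : Set Vars} {Φ : Vars → Vars}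

theorem continuousOn_fderiv_apply (hU : IsOpen U) (hΦ : ContDiffOn ℝ ∞ Φ U) (v : Vars) :
    ContinuousOn (fun z => fderiv ℝ Φ z v) U :=
  (hΦ.continuousOn_fderiv_of_isOpen hU (by simp)).clm_apply continuousOn_const

theorem fderiv_components (hU : IsOpen U) (hΦ : ContDiffOn ℝ ∞ Φ U) {z : Vars} (hz : z ∈ U)
    (v : Vars) :
    fderiv ℝ Φ z v = ((pd v (fun z => (Φ z).1.1) z, pd v (fun z => (Φ z).1.2.1) z,
      pd v (fun z => (Φ z).1.2.2) z), pd v (fun z => (Φ z).2) z) := by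
  have h : HasFDerivAt Φ (fderiv ℝ Φ z) z :=
    ((hΦ.contDiffAt (hU.mem_nhds hz)).differentiableAt (by simp)).hasFDerivAt
  unfold pd
  rw [h.fst.fst.fderiv, h.fst.snd.fst.fderiv, h.fst.snd.snd.fderiv, h.snd.fderiv]
  rfl

theorem eqOn_of_eqOn_regular (hU : IsOpen U) (hΦ : ContDiffOn ℝ ∞ Φ U)
    (hinj : ∀ z ∈ U, Function.Injective (fderiv ℝ Φ z)) (α α' : ℝ) {f g : Vars → ℝ}
    (hf : ContinuousOn f U) (hg : ContinuousOn g U)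
    (h : ∀ z ∈ U, z.1.2.1 ≠ α → (Φ z).1.2.1 ≠ α' → f z = g z) : ∀ z ∈ U, f z = g z := by
  have hX : ∀ z ∈ U, fderiv ℝ (fun z => (Φ z).1.2.1) z ≠ 0 := by
    intro z hz h0
    have hsurj : Function.Surjective (fderiv ℝ Φ z) :=
      (LinearMap.injective_iff_surjective (f := (fderiv ℝ Φ z : Vars →ₗ[ℝ] Vars))).1 (hinj z hz)
    obtain ⟨v, hv⟩ := hsurj eX
    rw [fderiv_components hU hΦ hz] at hv
    have h1 := congrArg (fun w : Vars => w.1.2.1) hv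
    simp [pd, h0] at h1
  exact EqOn.of_subset_closure (s := {z | z ∈ U ∧ z.1.2.1 ≠ α ∧ (Φ z).1.2.1 ≠ α'})
    (fun z hz => h z hz.1 hz.2.1 hz.2.2) hf hg (fun z hz => hz.1)
    (subset_closure_regular hU hX α α')

end Extension

section Determining

variable {U : Set Vars} {Φ : Vars → Vars} {g : Params → Params}

theorem isTYProjectable_of_mapsEquation (hU : IsOpen U) (hΦ : ContDiffOn ℝ ∞ Φ U)
    (hinj : ∀ z ∈ U, Function.Injective (fderiv ℝ Φ z))
    (hM : ∀ θ, MapsEquation U Φ θ (g θ)) : IsTYProjectable U Φ := by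
  have hX := (continuousOn_fderiv_apply hU hΦ eX).fst
  have hu := (continuousOn_fderiv_apply hU hΦ eU).fst
  have key : ∀ z ∈ U, z.1.2.1 ≠ 0 → (Φ z).1.2.1 ≠ (g (0, 0)).1 → _ := fun z hz h1 h2 =>
    fderiv_x_u_of_mapsEquation hU hΦ (hinj z hz) (hM (0, 0)) hz h1 h2
  have ext := fun {f g' : Vars → ℝ} => eqOn_of_eqOn_regular (f := f) (g := g') hU hΦ hinj 0
    (g (0, 0)).1
  refine fun z hz => ⟨⟨?_, ?_⟩, ?_, ?_⟩
  · exact ext hX.fst continuousOn_const (fun z hz h1 h2 => (key z hz h1 h2).1.1) z hz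
  · exact ext hX.snd.snd continuousOn_const (fun z hz h1 h2 => (key z hz h1 h2).1.2) z hz
  · exact ext hu.fst continuousOn_const (fun z hz h1 h2 => (key z hz h1 h2).2.1) z hz
  · exact ext hu.snd.snd continuousOn_const (fun z hz h1 h2 => (key z hz h1 h2).2.2) z hz

theorem fderiv_u_x_eq_zero (hU : IsOpen U) (hΦ : ContDiffOn ℝ ∞ Φ U)
    (hinj : ∀ z ∈ U, Function.Injective (fderiv ℝ Φ z))
    (hM : ∀ θ, MapsEquation U Φ θ (g θ)) : ∀ z ∈ U, (fderiv ℝ Φ z eU).1.2.1 = 0 := by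
  have hP := isTYProjectable_of_mapsEquation hU hΦ hinj hM
  refine eqOn_of_eqOn_regular hU hΦ hinj 0 (g (0, 0)).1
    (continuousOn_fderiv_apply hU hΦ eU).fst.snd.fst continuousOn_const fun z hz h1 h2 => ?_
  by_contra hne
  have hδ := tyJacobian_ne_zero (hinj z hz) (hP z hz).1.1 (hP z hz).1.2 (hP z hz).2.1 (hP z hz).2.2
  have hA : 0 < |(Φ z).1.2.1 - (g (0, 0)).1| ^ (g (0, 0)).2 :=
    Real.rpow_pos_of_pos (abs_pos.2 (sub_ne_zero.2 h2)) _
  have e : ∀ k : ℝ, (fderiv ℝ Φ z eX).1.2.1 +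
      (k - (fderiv ℝ Φ z eX).1.2.1) / (fderiv ℝ Φ z eU).1.2.1 * (fderiv ℝ Φ z eU).1.2.1 = k :=
    fun k => by field_simp; ring
  have key : ∀ k : ℝ, k ≠ 0 → _ := fun k hk =>
    symbol_relation_zero hU hΦ hP (hinj z hz) (hM (0, 0)) hz h1 h2 1 0
      (b := (k - (fderiv ℝ Φ z eX).1.2.1) / (fderiv ℝ Φ z eU).1.2.1) (by rwa [e k])
  have k1 := key 1 one_ne_zero
  have k2 := key 2 two_ne_zero
  rw [e] at k1 k2
  have : tyJacobian (fderiv ℝ Φ z) * |(Φ z).1.2.1 - (g (0, 0)).1| ^ (g (0, 0)).2 = 0 := by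
    linarith
  exact (mul_ne_zero hδ hA.ne') this

theorem fderiv_x_x_ne_zero (hU : IsOpen U) (hΦ : ContDiffOn ℝ ∞ Φ U)
    (hinj : ∀ z ∈ U, Function.Injective (fderiv ℝ Φ z))
    (hM : ∀ θ, MapsEquation U Φ θ (g θ)) : ∀ z ∈ U, (fderiv ℝ Φ z eX).1.2.1 ≠ 0 := by
  intro z hz h0
  have hP := isTYProjectable_of_mapsEquation hU hΦ hinj hM z hz
  have hu := fderiv_u_x_eq_zero hU hΦ hinj hM z hz
  set L := fderiv ℝ Φ z with hL
  have h1 : L ((L eU).2 • eX - (L eX).2 • eU) = 0 := by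
    rw [map_sub, map_smul, map_smul]
    ext
    · simp [hP.1.1, hP.2.1]
    · simp [h0, hu]
    · simp [hP.1.2, hP.2.2]
    · simp; ring
  have h2 := hinj z hz (h1.trans (map_zero L).symm)
  have h4 : (L eX).2 = 0 := by simpa using congrArg (fun w : Vars => w.2) h2
  have h5 : L eX = 0 := by
    ext
    · simp [hP.1.1]
    · simp [h0]
    · simp [hP.1.2]
    · simp [h4]
  have h6 : eX = 0 := hinj z hz (h5.trans (map_zero L).symm)
  simpa using congrArg (fun w : Vars => w.1.2.1) h6

theorem continuousOn_tyJacobian (hU : IsOpen U) (hΦ : ContDiffOn ℝ ∞ Φ U) :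
    ContinuousOn (fun z => tyJacobian (fderiv ℝ Φ z)) U := by
  have hT := (continuousOn_fderiv_apply hU hΦ eT).fst
  have hY := (continuousOn_fderiv_apply hU hΦ eY).fst
  exact (hT.fst.mul hY.snd.snd).sub (hY.fst.mul hT.snd.snd)

/-- The first-order determining equations for the components of `(t, x, y)`. -/
theorem determining_equations (hU : IsOpen U) (hΦ : ContDiffOn ℝ ∞ Φ U)
    (hinj : ∀ z ∈ U, Function.Injective (fderiv ℝ Φ z))
    (hM : ∀ θ, MapsEquation U Φ θ (g θ)) :
    (∀ z ∈ U, (fderiv ℝ Φ z eT).1.2.1 = 0) ∧ (∀ z ∈ U, (fderiv ℝ Φ z eY).1.2.1 = 0) ∧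
    (∀ z ∈ U, (fderiv ℝ Φ z eX).1.2.1 ^ 2 = 1) ∧
    (∀ z ∈ U, (fderiv ℝ Φ z eY).1.2.2 - (Φ z).1.2.1 * (fderiv ℝ Φ z eY).1.1 =
      tyJacobian (fderiv ℝ Φ z)) ∧
    (∀ z ∈ U, (Φ z).1.2.1 * (fderiv ℝ Φ z eT).1.1 - (fderiv ℝ Φ z eT).1.2.2 =
      z.1.2.1 * tyJacobian (fderiv ℝ Φ z)) := by
  have hP := isTYProjectable_of_mapsEquation hU hΦ hinj hM
  have hu := fderiv_u_x_eq_zero hU hΦ hinj hM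
  have hx0 := fderiv_x_x_ne_zero hU hΦ hinj hM
  have hδ : ∀ z ∈ U, tyJacobian (fderiv ℝ Φ z) ≠ 0 := fun z hz =>
    tyJacobian_ne_zero (hinj z hz) (hP z hz).1.1 (hP z hz).1.2 (hP z hz).2.1 (hP z hz).2.2
  have hb : ∀ z ∈ U, (fderiv ℝ Φ z eX).1.2.1 + 0 * (fderiv ℝ Φ z eU).1.2.1 ≠ 0 := fun z hz => by
    simpa using hx0 z hz
  have hT := (continuousOn_fderiv_apply hU hΦ eT).fst
  have hX := (continuousOn_fderiv_apply hU hΦ eX).fst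
  have hY := (continuousOn_fderiv_apply hU hΦ eY).fst
  have hΦX : ContinuousOn (fun z => (Φ z).1.2.1) U := hΦ.continuousOn.fst.snd.fst
  have hxc : ContinuousOn (fun z : Vars => z.1.2.1) U := by fun_prop
  have hδc := continuousOn_tyJacobian hU hΦ
  set F : Vars → ℝ := fun z => ((fderiv ℝ Φ z eY).1.2.2 - (Φ z).1.2.1 * (fderiv ℝ Φ z eY).1.1) *
    (fderiv ℝ Φ z eX).1.2.1 ^ 2 / tyJacobian (fderiv ℝ Φ z) with hF
  have hFc : ContinuousOn F U :=
    ((hY.snd.snd.sub (hΦX.mul hY.fst)).mul (hX.snd.fst.pow 2)).div hδc hδ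
  have law : ∀ θ : Params, θ.2 ≠ 1 → θ.2 ≠ 2 → ∀ z ∈ U, z.1.2.1 ≠ θ.1 → (Φ z).1.2.1 ≠ (g θ).1 →
      F z * |z.1.2.1 - θ.1| ^ θ.2 = |(Φ z).1.2.1 - (g θ).1| ^ (g θ).2 := by
    intro θ h1 h2 z hz h3 h4
    have := symbol_relation_general hU hΦ hP (hinj z hz) (hM θ) h1 h2 hz h3 h4 (hb z hz)
    rw [zero_mul, add_zero] at this
    rw [hF]
    simp only
    rw [div_mul_eq_mul_div, this, mul_div_cancel_left₀ _ (hδ z hz)]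
  have key : ∀ z ∈ U, z.1.2.1 ≠ 0 → (Φ z).1.2.1 ≠ (g (0, 0)).1 →
      (fderiv ℝ Φ z eT).1.2.1 = 0 ∧ (fderiv ℝ Φ z eY).1.2.1 = 0 ∧
      (fderiv ℝ Φ z eX).1.2.1 ^ 2 = 1 ∧ F z = 1 := by
    intro z hz h1 h2
    have hF0 : 0 < F z := by
      have h3 := law (0, 0) (by simp) (by simp) z hz h1 h2
      rw [Real.rpow_zero, mul_one] at h3
      rw [h3]
      exact Real.rpow_pos_of_pos (abs_pos.2 (sub_ne_zero.2 h2)) _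
    have hd : HasFDerivAt (fun z => (Φ z).1.2.1) (fderiv ℝ (fun z => (Φ z).1.2.1) z) z :=
      (differentiableAt_of_contDiffOn hU hΦ.fst.snd.fst hz).hasFDerivAt
    have hc := fun v => fderiv_components hU hΦ hz v
    simp only [pd] at hc
    have hUz := hU.mem_nhds hz
    have := rigidity_of_power_laws (F := F) hd (by have := hx0 z hz; rwa [hc] at this)
      (eventually_of_mem hUz fun w hw => hΦX.continuousAt (hU.mem_nhds hw))
      (eventually_of_mem hUz fun w hw => hFc.continuousAt (hU.mem_nhds hw)) hF0
      (θ₁ := g (z.1.2.1, -2)) (θ₂ := g (z.1.2.1, -4))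
      (eventually_of_mem hUz fun w hw h3 h4 =>
        law (z.1.2.1, -2) (by norm_num) (by norm_num) w hw h3 h4)
      (eventually_of_mem hUz fun w hw h3 h4 =>
        law (z.1.2.1, -4) (by norm_num) (by norm_num) w hw h3 h4)
    simpa only [hc] using this
  have ext := fun {f g' : Vars → ℝ} => eqOn_of_eqOn_regular (f := f) (g := g') hU hΦ hinj 0
    (g (0, 0)).1
  have hF1 : ∀ z ∈ U, z.1.2.1 ≠ 0 → (Φ z).1.2.1 ≠ (g (0, 0)).1 →
      (fderiv ℝ Φ z eY).1.2.2 - (Φ z).1.2.1 * (fderiv ℝ Φ z eY).1.1 =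
      tyJacobian (fderiv ℝ Φ z) := by
    intro z hz h1 h2
    obtain ⟨-, -, h3, h4⟩ := key z hz h1 h2
    have hδz := hδ z hz
    simp only [hF, h3, mul_one] at h4
    field_simp at h4
    exact h4
  refine ⟨?_, ?_, ?_, ?_, ?_⟩
  · exact ext hT.snd.fst continuousOn_const fun z hz h1 h2 => (key z hz h1 h2).1
  · exact ext hY.snd.fst continuousOn_const fun z hz h1 h2 => (key z hz h1 h2).2.1
  · exact ext (hX.snd.fst.pow 2) continuousOn_const fun z hz h1 h2 => (key z hz h1 h2).2.2.1
  · exact ext (hY.snd.snd.sub (hΦX.mul hY.fst)) hδc hF1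
  · refine ext ((hΦX.mul hT.fst).sub hT.snd.snd) (hxc.mul hδc) fun z hz h1 h2 => ?_
    obtain ⟨-, -, h3, h4⟩ := key z hz h1 h2
    have h5 := symbol_relation_zero hU hΦ hP (hinj z hz) (hM (0, 0)) hz h1 h2 0 1 (hb z hz)
    have h6 := law (0, 0) (by simp) (by simp) z hz h1 h2
    rw [Real.rpow_zero, h4] at h6
    simp only [zero_mul, add_zero, h3, ← h6] at h5
    linear_combination h5

end Determining

section PartialDerivatives

variable {U : Set Vars} {f : Vars → ℝ}

theorem pd_pd_eq (hU : IsOpen U) (hf : ContDiffOn ℝ ∞ f U) (v w : Vars) {z : Vars}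
    (hz : z ∈ U) : pd v (pd w f) z = fderiv ℝ (fderiv ℝ f) z v w := by
  have hd : DifferentiableAt ℝ (fderiv ℝ f) z :=
    ((hf.contDiffAt (hU.mem_nhds hz)).fderiv_right (m := 1) (by norm_cast)).differentiableAt
      (by simp)
  unfold pd
  rw [(hd.hasFDerivAt.clm_apply (hasFDerivAt_const w z)).fderiv]
  simp

theorem pd_pd_eq_zero (hU : IsOpen U) (hf : ContDiffOn ℝ ∞ f U) {v : Vars} {c : ℝ}
    (h : ∀ z ∈ U, pd v f z = c) (w : Vars) : ∀ z ∈ U, pd v (pd w f) z = 0 := by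
  intro z hz
  rw [pd_comm hU hf v w hz]
  exact pd_eq_zero_of_eqOn_const hU h w z hz

theorem contDiffOn_x : ContDiffOn ℝ ∞ (fun z : Vars => z.1.2.1) U := by fun_prop

theorem exists_affine_of_pd (hU : IsOpen U) (hUc : IsConnected U) (hf : ContDiffOn ℝ ∞ f U)
    {a b c d : ℝ} (ht : ∀ z ∈ U, pd eT f z = a) (hx : ∀ z ∈ U, pd eX f z = b)
    (hy : ∀ z ∈ U, pd eY f z = c) (hu : ∀ z ∈ U, pd eU f z = d) :
    ∃ k, ∀ z ∈ U, f z = a * z.1.1 + b * z.1.2.1 + c * z.1.2.2 + d * z.2 + k := by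
  set A : Vars →L[ℝ] ℝ := (covector a b c).comp (ContinuousLinearMap.fst ℝ Base ℝ) +
    d • ContinuousLinearMap.snd ℝ Base ℝ with hA
  have hAs : ContDiffOn ℝ ∞ A U := A.contDiff.contDiffOn
  have hAd : ∀ v z, pd v A z = A v := fun v z => by simp [pd]
  obtain ⟨k, hk⟩ := exists_eq_const_of_pd (f := fun z => f z - A z) hU hUc (hf.sub hAs)
    (fun z hz => by rw [pd_sub hU hf hAs _ hz, ht z hz, hAd]; simp [hA])
    (fun z hz => by rw [pd_sub hU hf hAs _ hz, hx z hz, hAd]; simp [hA])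
    (fun z hz => by rw [pd_sub hU hf hAs _ hz, hy z hz, hAd]; simp [hA])
    (fun z hz => by rw [pd_sub hU hf hAs _ hz, hu z hz, hAd]; simp [hA])
  refine ⟨k, fun z hz => ?_⟩
  have := hk z hz
  simp [hA] at this
  linarith

/-- The vector fields `∂/∂x` and `∂/∂t + x ∂/∂y` generate `∂/∂y`. -/
theorem pd_y_eq_zero_of_kolmogorov (hU : IsOpen U) (hf : ContDiffOn ℝ ∞ f U)
    (hx : ∀ z ∈ U, pd eX f z = 0)
    (h : ∀ z ∈ U, pd eT f z + z.1.2.1 * pd eY f z = 0) :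
    (∀ z ∈ U, pd eT f z = 0) ∧ ∀ z ∈ U, pd eY f z = 0 := by
  have hY := contDiffOn_pd hU hf eY
  have hy : ∀ z ∈ U, pd eY f z = 0 := by
    intro z hz
    have h1 := pd_eq_zero_of_eqOn_const hU h eX z hz
    rw [pd_add hU (contDiffOn_pd hU hf eT) (contDiffOn_x.mul hY) _ hz,
      pd_mul hU contDiffOn_x hY _ hz, pd_x, pd_pd_eq_zero hU hf hx eT z hz,
      pd_pd_eq_zero hU hf hx eY z hz] at h1
    simpa using h1
  refine ⟨fun z hz => ?_, hy⟩
  simpa [hy z hz] using h z hz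

theorem pd_kolmogorov (hU : IsOpen U) (hf : ContDiffOn ℝ ∞ f U)
    (h : ∀ z ∈ U, pd eT f z + z.1.2.1 * pd eY f z = 0) (w : Vars) :
    ∀ z ∈ U, pd eT (pd w f) z + z.1.2.1 * pd eY (pd w f) z + w.1.2.1 * pd eY f z = 0 := by
  intro z hz
  have hY := contDiffOn_pd hU hf eY
  have h1 := pd_eq_zero_of_eqOn_const hU h w z hz
  rw [pd_add hU (contDiffOn_pd hU hf eT) (contDiffOn_x.mul hY) _ hz,
    pd_mul hU contDiffOn_x hY _ hz, pd_x, pd_comm hU hf w eT hz, pd_comm hU hf w eY hz] at h1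
  linarith

/-- The general common solution of the determining equations for the `u`-component. -/
theorem exists_form_of_kolmogorov (hU : IsOpen U) (hUc : IsConnected U)
    (hf : ContDiffOn ℝ ∞ f U) (hxx : ∀ z ∈ U, pd eX (pd eX f) z = 0)
    (hxu : ∀ z ∈ U, pd eX (pd eU f) z = 0) (huu : ∀ z ∈ U, pd eU (pd eU f) z = 0)
    (h : ∀ z ∈ U, pd eT f z + z.1.2.1 * pd eY f z = 0) :
    ∃ c₃ c₄ c₅ c₆ : ℝ, ∀ z ∈ U,
      f z = c₃ * z.2 + c₄ * (z.1.1 * z.1.2.1 - z.1.2.2) + c₅ * z.1.2.1 + c₆ := by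
  have hT := contDiffOn_pd hU hf eT
  have hX := contDiffOn_pd hU hf eX
  have hY := contDiffOn_pd hU hf eY
  have hV := contDiffOn_pd hU hf eU
  obtain ⟨hut, huy⟩ := pd_y_eq_zero_of_kolmogorov hU hV hxu
    (fun z hz => by simpa using pd_kolmogorov hU hf h eU z hz)
  have hxe : ∀ z ∈ U, pd eT (pd eX f) z + z.1.2.1 * pd eY (pd eX f) z + pd eY f z = 0 :=
    fun z hz => by simpa using pd_kolmogorov hU hf h eX z hz
  have hxy : ∀ z ∈ U, pd eY (pd eX f) z = 0 := by
    intro z hz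
    have hXY := contDiffOn_pd hU hX eY
    have h1 := pd_eq_zero_of_eqOn_const hU hxe eX z hz
    rw [pd_add hU ((contDiffOn_pd hU hX eT).add (contDiffOn_x.mul hXY)) hY _ hz,
      pd_add hU (contDiffOn_pd hU hX eT) (contDiffOn_x.mul hXY) _ hz,
      pd_mul hU contDiffOn_x hXY _ hz, pd_x, pd_pd_eq_zero hU hX hxx eT z hz,
      pd_pd_eq_zero hU hX hxx eY z hz, pd_comm hU hf eX eY hz] at h1
    simp only [zero_add, mul_zero] at h1
    linarith
  have hyx : ∀ z ∈ U, pd eX (pd eY f) z = 0 := fun z hz => by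
    rw [pd_comm hU hf eX eY hz, hxy z hz]
  have hyu : ∀ z ∈ U, pd eU (pd eY f) z = 0 := fun z hz => by
    rw [pd_comm hU hf eU eY hz, huy z hz]
  have hxu' : ∀ z ∈ U, pd eU (pd eX f) z = 0 := fun z hz => by
    rw [pd_comm hU hf eU eX hz, hxu z hz]
  obtain ⟨hyt, hyy⟩ := pd_y_eq_zero_of_kolmogorov hU hY hyx
    (fun z hz => by simpa using pd_kolmogorov hU hf h eY z hz)
  obtain ⟨c₃, h₃⟩ := exists_eq_const_of_pd hU hUc hV hut hxu huy huu
  obtain ⟨k, h₄⟩ := exists_eq_const_of_pd hU hUc hY hyt hyx hyy hyu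
  obtain ⟨c₅, h₅⟩ := exists_affine_of_pd hU hUc hX (a := -k) (b := 0) (c := 0) (d := 0)
    (fun z hz => by have := hxe z hz; rw [hxy z hz, h₄ z hz] at this; linarith) hxx hxy hxu'
  have hq : ContDiffOn ℝ ∞ (fun z : Vars => -k * z.1.1 * z.1.2.1) U := by fun_prop
  have hqd : ∀ v z : Vars, pd v (fun z : Vars => -k * z.1.1 * z.1.2.1) z =
      -k * (v.1.1 * z.1.2.1 + z.1.1 * v.1.2.1) := fun v z => by
    have h1 : HasFDerivAt (fun z : Vars => z) (ContinuousLinearMap.id ℝ Vars) z := hasFDerivAt_id z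
    unfold pd
    rw [((h1.fst.fst.const_mul (-k)).fun_mul h1.fst.snd.fst).fderiv]
    simp
    ring
  obtain ⟨c₆, h₆⟩ := exists_affine_of_pd (f := fun z => f z - -k * z.1.1 * z.1.2.1) hU hUc
    (hf.sub hq) (a := 0) (b := c₅) (c := k) (d := c₃)
    (fun z hz => by
      rw [pd_sub hU hf hq _ hz, hqd]
      have := h z hz
      rw [h₄ z hz] at this
      simp only [one_mul, mul_zero, add_zero]
      linarith)
    (fun z hz => by
      rw [pd_sub hU hf hq _ hz, hqd, h₅ z hz]
      simp)
    (fun z hz => by rw [pd_sub hU hf hq _ hz, hqd, h₄ z hz]; simp)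
    (fun z hz => by rw [pd_sub hU hf hq _ hz, hqd, h₃ z hz]; simp)
  refine ⟨c₃, -k, c₅, c₆, fun z hz => ?_⟩
  have := h₆ z hz
  linarith

end PartialDerivatives

section Form

variable {U : Set Vars} {Φ : Vars → Vars} {g : Params → Params}

/-- The form of the `(t, x, y)`-components. -/
theorem exists_base_form (hU : IsOpen U) (hUc : IsConnected U) (hΦ : ContDiffOn ℝ ∞ Φ U)
    (hinj : ∀ z ∈ U, Function.Injective (fderiv ℝ Φ z))
    (hM : ∀ θ, MapsEquation U Φ θ (g θ)) :
    ∃ ε c₀ c₁ c₂ : ℝ, (ε = 1 ∨ ε = -1) ∧ ∀ z ∈ U,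
      (Φ z).1 = (z.1.1 + c₀, ε * z.1.2.1 + c₁, ε * z.1.2.2 + c₁ * z.1.1 + c₂) := by
  have hP := isTYProjectable_of_mapsEquation hU hΦ hinj hM
  have hXu := fderiv_u_x_eq_zero hU hΦ hinj hM
  obtain ⟨hXt, hXy, hXx, e₁, e₂⟩ := determining_equations hU hΦ hinj hM
  have hδ : ∀ z ∈ U, tyJacobian (fderiv ℝ Φ z) ≠ 0 := fun z hz =>
    tyJacobian_ne_zero (hinj z hz) (hP z hz).1.1 (hP z hz).1.2 (hP z hz).2.1 (hP z hz).2.2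
  have hc := fun z hz v => fderiv_components hU hΦ (z := z) hz v
  set τ : Vars → ℝ := fun z => (Φ z).1.1 with hτ
  set ξ : Vars → ℝ := fun z => (Φ z).1.2.1 with hξ
  set η : Vars → ℝ := fun z => (Φ z).1.2.2 with hη
  have sτ : ContDiffOn ℝ ∞ τ U := hΦ.fst.fst
  have sξ : ContDiffOn ℝ ∞ ξ U := hΦ.fst.snd.fst
  have sη : ContDiffOn ℝ ∞ η U := hΦ.fst.snd.snd
  have τx : ∀ z ∈ U, pd eX τ z = 0 := fun z hz => by have := (hP z hz).1.1; rwa [hc z hz] at this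
  have ηx : ∀ z ∈ U, pd eX η z = 0 := fun z hz => by have := (hP z hz).1.2; rwa [hc z hz] at this
  have τu : ∀ z ∈ U, pd eU τ z = 0 := fun z hz => by have := (hP z hz).2.1; rwa [hc z hz] at this
  have ηu : ∀ z ∈ U, pd eU η z = 0 := fun z hz => by have := (hP z hz).2.2; rwa [hc z hz] at this
  have ξu : ∀ z ∈ U, pd eU ξ z = 0 := fun z hz => by have := hXu z hz; rwa [hc z hz] at this
  have ξt : ∀ z ∈ U, pd eT ξ z = 0 := fun z hz => by have := hXt z hz; rwa [hc z hz] at this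
  have ξy : ∀ z ∈ U, pd eY ξ z = 0 := fun z hz => by have := hXy z hz; rwa [hc z hz] at this
  have ξx : ∀ z ∈ U, pd eX ξ z ^ 2 = 1 := fun z hz => by have := hXx z hz; rwa [hc z hz] at this
  have hJ : ∀ z ∈ U, tyJacobian (fderiv ℝ Φ z) =
      pd eT τ z * pd eY η z - pd eY τ z * pd eT η z := fun z hz => by
    unfold tyJacobian
    simp only [hc z hz]
  have e₁' : EqOn (fun z => pd eY η z - ξ z * pd eY τ z)
      (fun z => pd eT τ z * pd eY η z - pd eY τ z * pd eT η z) U := fun z hz => by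
    have := e₁ z hz
    rw [hJ z hz] at this
    simpa only [hc z hz] using this
  have sD : ∀ {f : Vars → ℝ}, ContDiffOn ℝ ∞ f U → ∀ v, ContDiffOn ℝ ∞ (pd v f) U :=
    fun hf v => contDiffOn_pd hU hf v
  have ξx0 : ∀ z ∈ U, pd eX ξ z ≠ 0 := fun z hz h0 => by
    have := ξx z hz
    rw [h0] at this
    norm_num at this
  have τy : ∀ z ∈ U, pd eY τ z = 0 := by
    intro z hz
    have := pd_congr hU e₁' eX hz
    rw [pd_sub hU (sD sη eY) (sξ.mul (sD sτ eY)) _ hz, pd_mul hU sξ (sD sτ eY) _ hz,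
      pd_sub hU ((sD sτ eT).mul (sD sη eY)) ((sD sτ eY).mul (sD sη eT)) _ hz,
      pd_mul hU (sD sτ eT) (sD sη eY) _ hz, pd_mul hU (sD sτ eY) (sD sη eT) _ hz,
      pd_pd_eq_zero hU sη ηx eY z hz, pd_pd_eq_zero hU sη ηx eT z hz,
      pd_pd_eq_zero hU sτ τx eY z hz, pd_pd_eq_zero hU sτ τx eT z hz] at this
    simpa [ξx0 z hz] using this
  have τt : ∀ z ∈ U, pd eT τ z = 1 := by
    intro z hz
    have h1 := e₁' hz
    have h2 := hδ z hz
    rw [hJ z hz] at h2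
    simp only [τy z hz, zero_mul, mul_zero, sub_zero] at h1 h2
    have h3 := (mul_ne_zero_iff.1 h2).2
    apply mul_right_cancel₀ h3
    rw [one_mul, ← h1]
  have e₂' : EqOn (fun z => ξ z - pd eT η z) (fun z => z.1.2.1 * pd eY η z) U := fun z hz => by
    have := e₂ z hz
    rw [hJ z hz] at this
    simpa only [hc z hz, τt z hz, τy z hz, mul_one, one_mul, zero_mul, sub_zero] using this
  have ξη : ∀ z ∈ U, pd eX ξ z = pd eY η z := by
    intro z hz
    have := pd_congr hU e₂' eX hz
    rw [pd_sub hU sξ (sD sη eT) _ hz, pd_mul hU contDiffOn_x (sD sη eY) _ hz, pd_x,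
      pd_pd_eq_zero hU sη ηx eY z hz, pd_pd_eq_zero hU sη ηx eT z hz] at this
    simpa using this
  have ξxx : ∀ z ∈ U, pd eX (pd eX ξ) z = 0 := by
    intro z hz
    have := pd_eq_zero_of_eqOn_const hU (f := fun z => pd eX ξ z * pd eX ξ z) (c := 1)
      (fun z hz => by rw [← ξx z hz, sq]) eX z hz
    rw [pd_mul hU (sD sξ eX) (sD sξ eX) _ hz] at this
    simpa [mul_comm, ← two_mul, ξx0 z hz] using this
  obtain ⟨ε, hε⟩ := exists_eq_const_of_pd hU hUc (sD sξ eX) (pd_pd_eq_zero hU sξ ξt eX) ξxx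
    (pd_pd_eq_zero hU sξ ξy eX) (pd_pd_eq_zero hU sξ ξu eX)
  obtain ⟨z₀, hz₀⟩ := hUc.nonempty
  have hεε : ε = 1 ∨ ε = -1 := by
    have := ξx z₀ hz₀
    rw [hε z₀ hz₀] at this
    rwa [sq, mul_self_eq_one_iff] at this
  obtain ⟨c₀, h₀⟩ := exists_affine_of_pd hU hUc sτ τt τx τy τu
  obtain ⟨c₁, h₁⟩ := exists_affine_of_pd hU hUc sξ ξt hε ξy ξu
  obtain ⟨c₂, h₂⟩ := exists_affine_of_pd hU hUc sη (a := c₁) (c := ε)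
    (fun z hz => by
      have := e₂' hz
      simp only [h₁ z hz, ← ξη z hz, hε z hz] at this
      linarith) ηx (fun z hz => by rw [← ξη z hz, hε z hz]) ηu
  refine ⟨ε, c₀, c₁, c₂, hεε, fun z hz => ?_⟩
  have h₀' := h₀ z hz
  have h₁' := h₁ z hz
  have h₂' := h₂ z hz
  simp only [hτ, hξ, hη] at h₀' h₁' h₂'
  ext
  · simp [h₀']
  · simp [h₁']
  · simp [h₂']; ring

end Form

section Forward

variable {U : Set Vars} {Φ : Vars → Vars} {g : Params → Params}

theorem param_of_mapsEquation (hU : IsOpen U) (hUn : U.Nonempty) (hΦ : ContDiffOn ℝ ∞ Φ U)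
    (hinj : ∀ z ∈ U, Function.Injective (fderiv ℝ Φ z))
    (hM : ∀ θ, MapsEquation U Φ θ (g θ)) {ε c₁ : ℝ} (hε : ε ≠ 0)
    (hX : ∀ z ∈ U, (Φ z).1.2.1 = ε * z.1.2.1 + c₁) {θ : Params} (h0 : θ.2 ≠ 0) (h1 : θ.2 ≠ 1)
    (h2 : θ.2 ≠ 2) : g θ = (ε * θ.1 + c₁, θ.2) := by
  have hP := isTYProjectable_of_mapsEquation hU hΦ hinj hM
  obtain ⟨-, -, hXx, e₁, -⟩ := determining_equations hU hΦ hinj hM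
  have hu := fderiv_u_x_eq_zero hU hΦ hinj hM
  have hx0 := fderiv_x_x_ne_zero hU hΦ hinj hM
  set G : Set Vars := {z | z ∈ U ∧ z.1.2.1 ≠ θ.1 ∧ ε * z.1.2.1 + c₁ ≠ (g θ).1} with hG
  have hGo : IsOpen G := hU.inter ((isOpen_ne_fun (by fun_prop) continuous_const).inter
    (isOpen_ne_fun (by fun_prop) continuous_const))
  have law : ∀ z ∈ G, θ.2 * Real.log (z.1.2.1 - θ.1) -
      (g θ).2 * Real.log (ε * z.1.2.1 + c₁ - (g θ).1) = 0 := by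
    rintro z ⟨hz, h3, h4⟩
    have h5 := symbol_relation_general hU hΦ hP (hinj z hz) (hM θ) h1 h2 hz h3
      (by rwa [hX z hz]) (b := 0) (by simpa using hx0 z hz)
    rw [zero_mul, add_zero, hXx z hz, mul_one, e₁ z hz] at h5
    have h6 := mul_left_cancel₀ (tyJacobian_ne_zero (hinj z hz) (hP z hz).1.1 (hP z hz).1.2
      (hP z hz).2.1 (hP z hz).2.2) h5
    have h7 := congrArg Real.log h6
    rw [hX z hz, Real.log_rpow (abs_pos.2 (sub_ne_zero.2 h3)),
      Real.log_rpow (abs_pos.2 (sub_ne_zero.2 h4)), Real.log_abs, Real.log_abs] at h7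
    linarith
  have hline : ∀ z : Vars, Continuous fun s : ℝ => z + s • eX := fun z => by fun_prop
  have hline0 : ∀ z ∈ G, ∀ᶠ s : ℝ in 𝓝 0, z + s • eX ∈ G := fun z hz =>
    ((hline z).tendsto 0).eventually (by simpa using hGo.mem_nhds hz)
  have rel : ∀ z ∈ G, θ.2 * (ε * z.1.2.1 + c₁ - (g θ).1) = (g θ).2 * ε * (z.1.2.1 - θ.1) := by
    intro z hz
    have n1 := sub_ne_zero.2 hz.2.1
    have n2 := sub_ne_zero.2 hz.2.2
    have d1 : HasDerivAt (fun s : ℝ => z.1.2.1 + s - θ.1) 1 0 :=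
      ((hasDerivAt_id (0 : ℝ)).const_add _).sub_const _
    have d2 : HasDerivAt (fun s : ℝ => ε * (z.1.2.1 + s) + c₁ - (g θ).1) (ε * 1) 0 :=
      ((((hasDerivAt_id (0 : ℝ)).const_add _).const_mul ε).add_const _).sub_const _
    have d3 := ((d1.log (by simpa using n1)).const_mul θ.2).fun_sub
      ((d2.log (by simpa using n2)).const_mul (g θ).2)
    have d4 := d3.unique ((hasDerivAt_const (0 : ℝ) (0 : ℝ)).congr_of_eventuallyEq (by
      filter_upwards [hline0 z hz] with s hs
      simpa using law _ hs))
    simp only [add_zero, mul_one] at d4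
    rw [sub_eq_zero, mul_one_div, ← mul_div_assoc, div_eq_div_iff n1 n2] at d4
    linear_combination d4
  obtain ⟨z, hzU⟩ := hUn
  have hzc : z ∈ closure G := by
    have hX' : ∀ w ∈ U, fderiv ℝ (fun w : Vars => ε * w.1.2.1 + c₁) w ≠ 0 := fun w _ h => by
      have h1 : HasFDerivAt (fun z : Vars => z) (ContinuousLinearMap.id ℝ Vars) w :=
        hasFDerivAt_id w
      rw [((h1.fst.snd.fst.const_mul ε).add_const c₁).fderiv] at h
      have := congrArg (fun l : Vars →L[ℝ] ℝ => l eX) h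
      simp [hε] at this
    exact subset_closure_regular hU hX' θ.1 (g θ).1 hzU
  obtain ⟨w, hw⟩ : G.Nonempty := closure_nonempty_iff.1 ⟨z, hzc⟩
  obtain ⟨s, hs, hs0⟩ := (((hline0 w hw).filter_mono (nhdsWithin_le_nhds (s := {0}ᶜ))).and
    self_mem_nhdsWithin).exists
  have r1 := rel w hw
  have r2 := rel _ hs
  have hs0' : s ≠ 0 := hs0
  simp only [Prod.fst_add, Prod.snd_add, Prod.smul_fst, Prod.smul_snd, smul_eq_mul, mul_one]
    at r2
  have hβ : θ.2 = (g θ).2 := by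
    apply mul_right_cancel₀ (mul_ne_zero hε hs0')
    linear_combination r2 - r1
  rw [← hβ] at r1
  have hα : (g θ).1 = ε * θ.1 + c₁ := by
    apply mul_left_cancel₀ h0
    linear_combination -r1
  exact Prod.ext hα hβ.symm

theorem kolmogorov_u_component (hU : IsOpen U) (hΦ : ContDiffOn ℝ ∞ Φ U)
    (hinj : ∀ z ∈ U, Function.Injective (fderiv ℝ Φ z))
    (hM : ∀ θ, MapsEquation U Φ θ (g θ)) {ε c₀ c₁ c₂ : ℝ} (hε : ε = 1 ∨ ε = -1)
    (hB : ∀ z ∈ U, (Φ z).1 = (z.1.1 + c₀, ε * z.1.2.1 + c₁, ε * z.1.2.2 + c₁ * z.1.1 + c₂))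
    (hg : ∀ θ : Params, g θ = (ε * θ.1 + c₁, θ.2)) {z : Vars} (hz : z ∈ U) (b : ℝ) :
    pd eT (fun z => (Φ z).2) z + z.1.2.1 * pd eY (fun z => (Φ z).2) z = 0 ∧
    pd ((0, 1, 0), b) (pd ((0, 1, 0), b) (fun z => (Φ z).2)) z = 0 := by
  have hP := isTYProjectable_of_mapsEquation hU hΦ hinj hM
  have hε0 : ε ≠ 0 := by rcases hε with h | h <;> simp [h]
  have hcomp := fun z hz v => fderiv_components hU hΦ (z := z) hz v
  have hid : ∀ w : Vars, HasFDerivAt (fun z : Vars => z) (ContinuousLinearMap.id ℝ Vars) w :=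
    fun w => hasFDerivAt_id w
  have hL : ∀ w ∈ U, ∀ v, (fderiv ℝ Φ w v).1 =
      (v.1.1, ε * v.1.2.1, ε * v.1.2.2 + c₁ * v.1.1) := by
    intro w hw v
    have h1 : HasFDerivAt Φ (fderiv ℝ Φ w) w :=
      ((hΦ.contDiffAt (hU.mem_nhds hw)).differentiableAt (by simp)).hasFDerivAt
    have h2 := (((hid w).fst.fst.add_const c₀).prodMk
      ((((hid w).fst.snd.fst.const_mul ε).add_const c₁).prodMk
      ((((hid w).fst.snd.snd.const_mul ε).fun_add ((hid w).fst.fst.const_mul c₁)).add_const c₂)))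
    have h3 := h1.fst.unique (h2.congr_of_eventuallyEq
      (eventually_of_mem (hU.mem_nhds hw) fun q hq => hB q hq))
    have h4 := congrArg (fun l : Vars →L[ℝ] Base => l v) h3
    simpa using h4
  set ν : Vars → ℝ := fun z => (Φ z).2 with hν
  set v : Vars := ((0, 1, 0), b) with hv
  have hM2 : (fderiv ℝ (fderiv ℝ Φ) z v v).1 = 0 := by
    have hX : (fderiv ℝ (fderiv ℝ Φ) z v v).1.2.1 = 0 :=
      fderiv_fderiv_component (F := projX) (k := ε) hU hΦ
        (fun w hw => by simp [hL w hw, hv]) hz v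
    obtain ⟨hT, hY⟩ := hP.fderiv_fderiv hU hΦ hz v b
    ext
    · exact hT
    · exact hX
    · exact hY
  have hM2' : (fderiv ℝ (fderiv ℝ Φ) z v v).2 = pd v (pd v ν) z := by
    have hd : DifferentiableAt ℝ (fderiv ℝ Φ) z :=
      ((hΦ.contDiffAt (hU.mem_nhds hz)).fderiv_right (m := 1)
        (by norm_cast)).differentiableAt (by simp)
    have h1 := (hd.hasFDerivAt.clm_apply (hasFDerivAt_const v z)).snd
    have h2 : pd v (pd v ν) z = pd v (fun w => (fderiv ℝ Φ w v).2) z :=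
      pd_congr hU (fun w hw => by rw [hcomp w hw]) v hz
    rw [h2, pd, h1.fderiv]
    simp
  have key : ∀ β : ℝ, β ≠ 1 → β ≠ 2 →
      pd eT ν z + z.1.2.1 * pd eY ν z = (2 : ℝ) ^ β * pd v (pd v ν) z := by
    intro β h1 h2
    have hXz : (Φ z).1.2.1 = ε * z.1.2.1 + c₁ := by rw [hB z hz]
    have hgθ := hg (z.1.2.1 + 2, β)
    have habs : |(Φ z).1.2.1 - (g (z.1.2.1 + 2, β)).1| = 2 := by
      rw [hXz, hgθ]
      have : ε * z.1.2.1 + c₁ - (ε * (z.1.2.1 + 2) + c₁) = -(ε * 2) := by ring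
      simp only [this]
      rcases hε with h | h <;> simp [h]
    obtain ⟨l, Q, S, s, i, ii, iii⟩ := exists_transformed_jet_general hU hΦ
      (hM (z.1.2.1 + 2, β)) h1 h2 hz (by simp) (by
        intro h
        rw [h, sub_self, abs_zero] at habs
        norm_num at habs) 0 b
      (transversal_of_ne_zero (hinj z hz) (hP z hz).1.1 (hP z hz).1.2 (hP z hz).2.1
        (hP z hz).2.2 (by simp [hL z hz, hε0]))
    have hS : S = 0 := by
      simpa [(Real.rpow_pos_of_pos (two_pos (α := ℝ)) β).ne'] using s
    have it := i (1, 0, 0)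
    have iy := i (0, 0, 1)
    have hLv : (fderiv ℝ Φ z v).1 = ε • (0, 1, 0) := by
      rw [hL z hz]
      simp [hv]
    rw [habs, hgθ] at iii
    simp only [covector_apply, mul_zero, zero_mul, add_zero] at it iy
    rw [hS, show ((0, 0) : Vars) = 0 from rfl, map_zero, add_zero, hM2, hM2', map_zero, add_zero,
      hLv, map_smul, map_smul, smul_apply, smul_eq_mul, smul_eq_mul, ← mul_assoc] at ii
    have hεε : ε * ε = 1 := by rcases hε with h | h <;> simp [h]
    rw [hεε, one_mul] at ii
    rw [base_clm_apply_eq, hL z hz, hcomp z hz] at it iy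
    simp only [mul_zero, mul_one, zero_mul, add_zero, zero_add, one_mul] at it iy
    rw [ii, hXz] at iii
    linear_combination iii - it - z.1.2.1 * iy
  have k1 := key (-2) (by norm_num) (by norm_num)
  have k2 := key (-4) (by norm_num) (by norm_num)
  have p2 : (2 : ℝ) ^ (-2 : ℝ) = 1 / 4 := by
    rw [Real.rpow_neg (by norm_num), Real.rpow_two]
    norm_num
  have p4 : (2 : ℝ) ^ (-4 : ℝ) = 1 / 16 := by
    rw [Real.rpow_neg (by norm_num), show (4 : ℝ) = ((4 : ℕ) : ℝ) by norm_num, Real.rpow_natCast]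
    norm_num
  rw [p2] at k1
  rw [p4] at k2
  constructor <;> linarith

/-- The form of the transformations that map equations of the class to equations of the
class. -/
theorem exists_form_of_mapsEquation (hU : IsOpen U) (hUc : IsConnected U)
    (hΦ : ContDiffOn ℝ ∞ Φ U) (hinj : ∀ z ∈ U, Function.Injective (fderiv ℝ Φ z))
    (hM : ∀ θ, MapsEquation U Φ θ (g θ)) (hgc : Continuous g) :
    ∃ ε c₀ c₁ c₂ c₃ c₄ c₅ c₆ : ℝ, (ε = 1 ∨ ε = -1) ∧ c₃ ≠ 0 ∧
      (∀ z ∈ U, Φ z = ((z.1.1 + c₀, ε * z.1.2.1 + c₁, ε * z.1.2.2 + c₁ * z.1.1 + c₂),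
        c₃ * z.2 + c₄ * (z.1.1 * z.1.2.1 - z.1.2.2) + c₅ * z.1.2.1 + c₆)) ∧
      ∀ θ, g θ = (ε * θ.1 + c₁, θ.2) := by
  obtain ⟨ε, c₀, c₁, c₂, hε, hB⟩ := exists_base_form hU hUc hΦ hinj hM
  have hε0 : ε ≠ 0 := by rcases hε with h | h <;> simp [h]
  have hg : ∀ θ, g θ = (ε * θ.1 + c₁, θ.2) := by
    rintro ⟨α, β⟩
    have hd : Dense ({0, 1, 2} : Set ℝ)ᶜ := (Set.toFinite _).countable.dense_compl ℝ
    have h1 : Continuous fun β => g (α, β) := hgc.comp (by fun_prop)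
    have h2 : Continuous fun β : ℝ => (ε * α + c₁, β) := by fun_prop
    refine congrFun (h1.ext_on hd h2 fun β hβ => ?_) β
    simp only [mem_compl_iff, mem_insert_iff, mem_singleton_iff, not_or] at hβ
    exact param_of_mapsEquation hU hUc.nonempty hΦ hinj hM hε0
      (fun z hz => by rw [hB z hz]) hβ.1 hβ.2.1 hβ.2.2
  have hk := fun z hz b => kolmogorov_u_component hU hΦ hinj hM hε hB hg (z := z) hz b
  have sν : ContDiffOn ℝ ∞ (fun z => (Φ z).2) U := hΦ.snd
  have hq : ∀ z ∈ U, ∀ b : ℝ, pd eX (pd eX (fun z => (Φ z).2)) z +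
      2 * b * pd eX (pd eU (fun z => (Φ z).2)) z +
      b ^ 2 * pd eU (pd eU (fun z => (Φ z).2)) z = 0 := by
    intro z hz b
    have h1 := (hk z hz b).2
    have h2 := pd_comm hU sν eX eU hz
    rw [pd_pd_eq hU sν _ _ hz] at h1 h2 ⊢
    rw [pd_pd_eq hU sν _ _ hz] at h2 ⊢
    rw [pd_pd_eq hU sν _ _ hz]
    have hv : (((0, 1, 0), b) : Vars) = eX + b • eU := by ext <;> simp
    rw [hv] at h1
    simp only [map_add, map_smul, add_apply, smul_apply, smul_eq_mul] at h1
    rw [← h2] at h1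
    linear_combination h1
  obtain ⟨c₃, c₄, c₅, c₆, hf⟩ := exists_form_of_kolmogorov hU hUc sν
    (fun z hz => by linarith [hq z hz 0])
    (fun z hz => by linarith [hq z hz 0, hq z hz 1, hq z hz (-1)])
    (fun z hz => by linarith [hq z hz 0, hq z hz 1, hq z hz (-1)])
    (fun z hz => (hk z hz 0).1)
  refine ⟨ε, c₀, c₁, c₂, c₃, c₄, c₅, c₆, hε, ?_, fun z hz => Prod.ext (hB z hz) (hf z hz), hg⟩
  rintro rfl
  obtain ⟨z, hz⟩ := hUc.nonempty
  have hP := isTYProjectable_of_mapsEquation hU hΦ hinj hM z hz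
  have hu := fderiv_u_x_eq_zero hU hΦ hinj hM z hz
  have hν : (fderiv ℝ Φ z eU).2 = 0 := by
    rw [fderiv_components hU hΦ hz]
    simp only
    rw [pd_congr hU hf eU hz]
    have hid : HasFDerivAt (fun z : Vars => z) (ContinuousLinearMap.id ℝ Vars) z :=
      hasFDerivAt_id z
    unfold pd
    rw [((((hid.snd.const_mul 0).fun_add (((hid.fst.fst.fun_mul hid.fst.snd.fst).fun_sub
      hid.fst.snd.snd).const_mul c₄)).fun_add (hid.fst.snd.fst.const_mul c₅)).add_const c₆).fderiv]
    simp
  have h0 : fderiv ℝ Φ z eU = fderiv ℝ Φ z 0 := by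
    rw [map_zero]
    ext
    · exact hP.2.1
    · exact hu
    · exact hP.2.2
    · exact hν
  simpa using congrArg Prod.snd (hinj z hz h0)

end Forward

section Converse

theorem hasDerivAt_line {E : Type*} [NormedAddCommGroup E] [NormedSpace ℝ E] {f : E → ℝ} {p : E}
    (hf : DifferentiableAt ℝ f p) (e : E) :
    HasDerivAt (fun s : ℝ => f (p + s • e)) (fderiv ℝ f p e) 0 := by
  have h1 : HasDerivAt (fun s : ℝ => p + s • e) e 0 := by
    simpa using ((hasDerivAt_id (0 : ℝ)).smul_const e).const_add p
  have h2 : HasFDerivAt f (fderiv ℝ f p) (p + (0 : ℝ) • e) := by simpa using hf.hasFDerivAt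
  exact h2.comp_hasDerivAt (0 : ℝ) h1

theorem IsLocalFunction.differentiableAt {θ : Params} {f : Base → ℝ} {W : Set Base}
    (h : IsLocalFunction θ f W) {p : Base} (hp : p ∈ W) :
    DifferentiableAt ℝ f p ∧ DifferentiableAt ℝ (dx f) p := by
  have hf := h.contDiffOn.contDiffAt (h.isOpen.mem_nhds hp)
  have hd : DifferentiableAt ℝ (fderiv ℝ f) p :=
    (hf.fderiv_right (m := 1) (by norm_cast)).differentiableAt (by simp)
  exact ⟨hf.differentiableAt (by simp), hd.clm_apply (differentiableAt_const _)⟩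

/-- The transformations of the stated form, in the space of variables. -/
def affineTransformation (ε c₀ c₁ c₂ c₃ c₄ c₅ c₆ : ℝ) (z : Vars) : Vars :=
  ((z.1.1 + c₀, ε * z.1.2.1 + c₁, ε * z.1.2.2 + c₁ * z.1.1 + c₂),
    c₃ * z.2 + c₄ * (z.1.1 * z.1.2.1 - z.1.2.2) + c₅ * z.1.2.1 + c₆)

theorem mapsEquation_affineTransformation (U : Set Vars) {ε c₀ c₁ c₂ c₃ c₄ c₅ c₆ : ℝ}
    (hε : ε = 1 ∨ ε = -1) (h₃ : c₃ ≠ 0) (θ : Params) :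
    MapsEquation U (affineTransformation ε c₀ c₁ c₂ c₃ c₄ c₅ c₆) θ (ε * θ.1 + c₁, θ.2) := by
  intro W W' f f' hf hf' _ him
  have hεε : ε * ε = 1 := by rcases hε with h | h <;> simp [h]
  set π : Base → Base := fun p => (p.1 + c₀, ε * p.2.1 + c₁, ε * p.2.2 + c₁ * p.1 + c₂) with hπ
  have hmem : ∀ q ∈ W, π q ∈ W' ∧
      f' (π q) = c₃ * f q + c₄ * (q.1 * q.2.1 - q.2.2) + c₅ * q.2.1 + c₆ := by
    intro q hq
    have : affineTransformation ε c₀ c₁ c₂ c₃ c₄ c₅ c₆ (q, f q) ∈ W'.graphOn f' :=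
      him ▸ mem_image_of_mem _ (mem_image_of_mem _ hq)
    obtain ⟨q', hq', h⟩ := this
    have h1 : q' = π q := congrArg Prod.fst h
    have h2 : f' q' = _ := congrArg Prod.snd h
    subst h1
    exact ⟨hq', h2⟩
  have hsurj : ∀ q' ∈ W', ∃ q ∈ W, π q = q' := by
    intro q' hq'
    have : (q', f' q') ∈ affineTransformation ε c₀ c₁ c₂ c₃ c₄ c₅ c₆ '' W.graphOn f :=
      him ▸ mem_image_of_mem _ hq'
    obtain ⟨-, ⟨q, hq, rfl⟩, h⟩ := this
    exact ⟨q, hq, congrArg Prod.fst h⟩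
  have hπl : ∀ (p e : Base) (s : ℝ),
      π (p + s • e) = π p + s • (e.1, ε * e.2.1, ε * e.2.2 + c₁ * e.1) := by
    intro p e s
    ext <;> simp [hπ] <;> ring
  have hline : ∀ p ∈ W, ∀ e : Base, ∀ᶠ s : ℝ in 𝓝 0, p + s • e ∈ W := by
    intro p hp e
    have hc : Continuous fun s : ℝ => p + s • e := by fun_prop
    exact (hc.tendsto 0).eventually (by simpa using hf.isOpen.mem_nhds hp)
  have first : ∀ p ∈ W, ∀ e : Base,
      fderiv ℝ f' (π p) (e.1, ε * e.2.1, ε * e.2.2 + c₁ * e.1) =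
        c₃ * fderiv ℝ f p e + c₄ * (e.1 * p.2.1 + p.1 * e.2.1 - e.2.2) + c₅ * e.2.1 := by
    intro p hp e
    have h1 := hasDerivAt_line (hf'.differentiableAt (hmem p hp).1).1
      (e.1, ε * e.2.1, ε * e.2.2 + c₁ * e.1)
    have h2 := hasDerivAt_line (hf.differentiableAt hp).1 e
    have hl : ∀ a b : ℝ, HasDerivAt (fun s : ℝ => a + s * b) b 0 := fun a b => by
      simpa using ((hasDerivAt_id (0 : ℝ)).mul_const b).const_add a
    have h3 := (((h2.const_mul c₃).fun_add ((((hl p.1 e.1).fun_mul (hl p.2.1 e.2.1)).fun_sub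
      (hl p.2.2 e.2.2)).const_mul c₄)).fun_add ((hl p.2.1 e.2.1).const_mul c₅)).add_const c₆
    have h4 := h1.unique (h3.congr_of_eventuallyEq (by
      filter_upwards [hline p hp e] with s hs
      rw [← hπl, (hmem _ hs).2]
      simp))
    rw [h4]
    simp
  have second : ∀ p ∈ W, dx (dx f') (π p) = c₃ * dx (dx f) p := by
    intro p hp
    have h1 := (hasDerivAt_line (hf'.differentiableAt (hmem p hp).1).2 (0, ε, 0)).const_mul ε
    have h2 := hasDerivAt_line (hf.differentiableAt hp).2 (0, 1, 0)
    have h3 := ((h2.const_mul c₃).add_const (c₄ * p.1)).add_const c₅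
    have he : ∀ l : Base →L[ℝ] ℝ, l (0, ε, 0) = ε * l (0, 1, 0) := fun l => by
      rw [← smul_eq_mul, ← map_smul]
      simp
    have h4 := h1.unique (h3.congr_of_eventuallyEq (by
      filter_upwards [hline p hp (0, 1, 0)] with s hs
      have h5 := first _ hs (0, 1, 0)
      rw [hπl] at h5
      simp only [mul_one, mul_zero, add_zero] at h5
      rw [he] at h5
      simp only [dx]
      rw [h5]
      simp))
    rw [he, ← mul_assoc, hεε, one_mul] at h4
    exact h4
  have key : ∀ p ∈ W,
      dt f' (π p) + (π p).2.1 * dy f' (π p) = c₃ * (dt f p + p.2.1 * dy f p) := by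
    intro p hp
    have ht := first p hp (1, 0, 0)
    have hy := first p hp (0, 0, 1)
    rw [base_clm_apply_eq] at ht hy
    simp only [mul_one, mul_zero, add_zero, zero_add, one_mul, zero_mul] at ht hy
    simp only [dt, dy, hπ] at ht hy ⊢
    linear_combination ht + p.2.1 * hy
  have habs : ∀ p : Base, |(π p).2.1 - (ε * θ.1 + c₁)| = |p.2.1 - θ.1| := by
    intro p
    have : (π p).2.1 - (ε * θ.1 + c₁) = ε * (p.2.1 - θ.1) := by simp only [hπ]; ring
    rw [this, abs_mul]
    rcases hε with h | h <;> simp [h]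
  constructor
  · intro h q' hq'
    obtain ⟨p, hp, rfl⟩ := hsurj q' hq'
    rw [key p hp, second p hp, h p hp]
    simp only [habs]
    ring
  · intro h p hp
    have h1 := h _ (hmem p hp).1
    rw [key p hp, second p hp] at h1
    simp only [habs] at h1
    apply mul_left_cancel₀ h₃
    linear_combination h1

theorem ContinuousLinearMap.det_ne_zero_iff_injective {E : Type*} [NormedAddCommGroup E]
    [NormedSpace ℝ E] [FiniteDimensional ℝ E] (A : E →L[ℝ] E) :
    A.det ≠ 0 ↔ Function.Injective A := by
  have h : A.det ≠ 0 ↔ IsUnit (A : E →ₗ[ℝ] E) := by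
    rw [LinearMap.isUnit_iff_isUnit_det, isUnit_iff_ne_zero]
  rw [h, LinearMap.isUnit_iff_ker_eq_bot, LinearMap.ker_eq_bot]
  rfl

theorem isPointTransformationOn_of_form {U : Set Vars} (hU : IsOpen U) {T : Joint → Joint}
    {ε c₀ c₁ c₂ c₃ c₄ c₅ c₆ : ℝ} (hε : ε ≠ 0) (h₃ : c₃ ≠ 0)
    (hT : ∀ w ∈ U ×ˢ (univ : Set Params), T w =
      (affineTransformation ε c₀ c₁ c₂ c₃ c₄ c₅ c₆ w.1, (ε * w.2.1 + c₁, w.2.2))) :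
    IsPointTransformationOn (U ×ˢ univ) T := by
  have hUo : IsOpen (U ×ˢ (univ : Set Params)) := hU.prod isOpen_univ
  constructor
  · refine ContDiffOn.congr (ContDiff.contDiffOn ?_) hT
    unfold affineTransformation
    fun_prop
  · intro w hw
    rw [ContinuousLinearMap.det_ne_zero_iff_injective,
      ((show EqOn T _ (U ×ˢ univ) from hT).eventuallyEq_of_mem (hUo.mem_nhds hw)).fderiv_eq]
    have hid : HasFDerivAt (fun w : Joint => w) (ContinuousLinearMap.id ℝ Joint) w :=
      hasFDerivAt_id w
    have hv := hid.fst
    have hd := (((hv.fst.fst.add_const c₀).prodMk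
      (((hv.fst.snd.fst.const_mul ε).add_const c₁).prodMk
      (((hv.fst.snd.snd.const_mul ε).fun_add (hv.fst.fst.const_mul c₁)).add_const c₂))).prodMk
      ((((hv.snd.const_mul c₃).fun_add (((hv.fst.fst.fun_mul hv.fst.snd.fst).fun_sub
        hv.fst.snd.snd).const_mul c₄)).fun_add (hv.fst.snd.fst.const_mul c₅)).add_const c₆)).prodMk
      (((hid.snd.fst.const_mul ε).add_const c₁).prodMk hid.snd.snd)
    unfold affineTransformation
    rw [hd.fderiv]
    refine (injective_iff_map_eq_zero _).2 fun v hv0 => ?_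
    have e1 := congrArg (fun w : Joint => w.1.1.1) hv0
    have e2 := congrArg (fun w : Joint => w.1.1.2.1) hv0
    have e3 := congrArg (fun w : Joint => w.1.1.2.2) hv0
    have e4 := congrArg (fun w : Joint => w.1.2) hv0
    have e5 := congrArg (fun w : Joint => w.2.1) hv0
    have e6 := congrArg (fun w : Joint => w.2.2) hv0
    simp [hε] at e1 e2 e5 e6
    simp [e1, hε] at e3
    simp [e1, e2, e3, h₃] at e4
    ext <;> assumption

end Converse

theorem exists_form_of_isEquivalenceTransformation {U : Set Vars} (hU : IsOpen U)
    (hUc : IsConnected U) {T : Joint → Joint} (hT : IsEquivalenceTransformation U T) :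
    ∃ ε c₀ c₁ c₂ c₃ c₄ c₅ c₆ : ℝ, (ε = 1 ∨ ε = -1) ∧ c₃ ≠ 0 ∧ ∀ z ∈ U, ∀ θ : Params,
      T (z, θ) = (affineTransformation ε c₀ c₁ c₂ c₃ c₄ c₅ c₆ z, (ε * θ.1 + c₁, θ.2)) := by
  obtain ⟨⟨hTs, hTd⟩, Φ, hΦT, hg⟩ := hT
  choose g hgT hM using hg
  have hmem : ∀ z ∈ U, ∀ θ : Params, (z, θ) ∈ U ×ˢ (univ : Set Params) := fun z hz θ =>
    ⟨hz, mem_univ _⟩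
  have hUo : IsOpen (U ×ˢ (univ : Set Params)) := hU.prod isOpen_univ
  have hΦ : ContDiffOn ℝ ∞ Φ U := by
    have h1 : ContDiffOn ℝ ∞ (fun z : Vars => (T (z, 0)).1) U :=
      (hTs.comp (f := fun z : Vars => (z, (0 : Params))) (by fun_prop)
        fun z hz => hmem z hz 0).fst
    exact h1.congr fun z hz => (hΦT z hz 0).symm
  have hinj : ∀ z ∈ U, Function.Injective (fderiv ℝ Φ z) := by
    intro z hz
    have h1 := (ContinuousLinearMap.det_ne_zero_iff_injective _).1 (hTd _ (hmem z hz 0))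
    have hs : Function.Surjective (fderiv ℝ T (z, 0)) :=
      (LinearMap.injective_iff_surjective (f := (fderiv ℝ T (z, 0) : Joint →ₗ[ℝ] Joint))).1 h1
    have hd : HasFDerivAt T (fderiv ℝ T (z, 0)) (z, 0) :=
      ((hTs.contDiffAt (hUo.mem_nhds (hmem z hz 0))).differentiableAt (by simp)).hasFDerivAt
    have hd' : HasFDerivAt Φ (fderiv ℝ Φ z) ((z, 0) : Joint).1 :=
      ((hΦ.contDiffAt (hU.mem_nhds hz)).differentiableAt (by simp)).hasFDerivAt
    have h2 := hd.fst.unique ((hd'.comp ((z, 0) : Joint) hasFDerivAt_fst).congr_of_eventuallyEq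
      (eventually_of_mem (hUo.mem_nhds (hmem z hz 0)) fun w hw => hΦT w.1 hw.1 w.2))
    refine (LinearMap.injective_iff_surjective (f := (fderiv ℝ Φ z : Vars →ₗ[ℝ] Vars))).2 ?_
    intro v
    obtain ⟨w, hw⟩ := hs (v, 0)
    refine ⟨w.1, ?_⟩
    have h3 := congrArg (fun l : Joint →L[ℝ] Vars => l w) h2
    simp [hw] at h3
    exact h3.symm
  have hgc : Continuous g := by
    obtain ⟨z, hz⟩ := hUc.nonempty
    have h1 : ContinuousOn (fun θ : Params => (T (z, θ)).2) univ :=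
      (hTs.continuousOn.comp (f := fun θ : Params => (z, θ)) (by fun_prop)
        fun θ _ => hmem z hz θ).snd
    exact (continuousOn_univ.1 h1).congr fun θ => hgT θ z hz
  obtain ⟨ε, c₀, c₁, c₂, c₃, c₄, c₅, c₆, hε, h₃, hf, hgf⟩ :=
    exists_form_of_mapsEquation hU hUc hΦ hinj hM hgc
  refine ⟨ε, c₀, c₁, c₂, c₃, c₄, c₅, c₆, hε, h₃, fun z hz θ => Prod.ext ?_ ?_⟩
  · rw [hΦT z hz, hf z hz]
    rfl
  · rw [hgT θ z hz, hgf]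

end KolmogorovClass

theorem mainTheorem3 (U : Set KolmogorovClass.Vars) (hUo : IsOpen U) (hUc : IsConnected U)
    (T : KolmogorovClass.Joint → KolmogorovClass.Joint) :
    KolmogorovClass.IsEquivalenceTransformation U T ↔
      ∃ ε c₀ c₁ c₂ c₃ c₄ c₅ c₆ : ℝ, (ε = 1 ∨ ε = -1) ∧ c₃ ≠ 0 ∧
        ∀ t x y u α β : ℝ, ((t, x, y), u) ∈ U →
          T (((t, x, y), u), (α, β)) =
            (((t + c₀, ε * x + c₁, ε * y + c₁ * t + c₂),
              c₃ * u + c₄ * (t * x - y) + c₅ * x + c₆), (ε * α + c₁, β)) := by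
  constructor
  · intro hT
    obtain ⟨ε, c₀, c₁, c₂, c₃, c₄, c₅, c₆, hε, h₃, h⟩ :=
      KolmogorovClass.exists_form_of_isEquivalenceTransformation hUo hUc hT
    exact ⟨ε, c₀, c₁, c₂, c₃, c₄, c₅, c₆, hε, h₃, fun t x y u α β hz => h _ hz (α, β)⟩
  · rintro ⟨ε, c₀, c₁, c₂, c₃, c₄, c₅, c₆, hε, h₃, h⟩
    have hε0 : ε ≠ 0 := by rcases hε with h | h <;> simp [h]
    have hT : ∀ w ∈ U ×ˢ (Set.univ : Set KolmogorovClass.Params), T w =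
        (KolmogorovClass.affineTransformation ε c₀ c₁ c₂ c₃ c₄ c₅ c₆ w.1,
          (ε * w.2.1 + c₁, w.2.2)) := fun w hw => h _ _ _ _ _ _ hw.1
    refine ⟨KolmogorovClass.isPointTransformationOn_of_form hUo hε0 h₃ hT,
      KolmogorovClass.affineTransformation ε c₀ c₁ c₂ c₃ c₄ c₅ c₆,
      fun z hz θ => by rw [hT _ ⟨hz, Set.mem_univ _⟩], fun θ => ⟨(ε * θ.1 + c₁, θ.2),
      fun z hz => by rw [hT _ ⟨hz, Set.mem_univ _⟩],
      KolmogorovClass.mapsEquation_affineTransformation U hε h₃ θ⟩⟩
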